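/- Let $Z=(Z_t)_{t\ge 0}$ be a real-valued Lévy process on a probability space, with generating triplet $(b,\sigma^2,\nu)$ relative to the truncation $\mathbf 1_{|x|\le 1}$, that is, $$\mathbb E e^{iuZ_t}=\exp\Big(t\Big[ibu-\tfrac{\sigma^2u^2}{2}+\int_{\mathbb R}\big(e^{iux}-1-iux\mathbf 1_{|x|\le1}\big)\nu(dx)\Big]\Big).$$ Assume that * $\nu(dx)=s(x)\,dx$ with $s\ge 0$, $s\in C^\infty(\mathbb R\setminus\{0\})$, and $\sup_{|x|>\delta}|s^{(k)}(x)|<\infty$ for all $k\ge 0$ and $\delta>0$; * $\int_{|x|>1}e^{c|x|}\nu(dx)<\infty$ for some $c>2$; * (martingale condition) $b=-\frac{\sigma^2}{2}-\int_{\mathbb R}\big(e^x-1-x\mathbf 1_{|x|\le 1}\big)\nu(dx)$. For $t>0$ put $G_t(z):=\mathbb E\,(e^{z+Z_t}-1)_+$. Let $z_0>0$, let $n\ge 1$ be an integer, and let $0<\varepsilon<\min\{z_0/(n+1),\,1\}$. Let $c_\varepsilon\in C^\infty(\mathbb R)$ be symmetric with $\mathbf 1_{[-\varepsilon/2,\varepsilon/2]}\le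 c_\varepsilon\le \mathbf 1_{[-\varepsilon,\varepsilon]}$, and put $$\bar s_\varepsilon:=(1-c_\varepsilon)s,\qquad \lambda_\varepsilon:=\int_{\mathbb R} (1-c_\varepsilon)\,d\nu,\qquad b_\varepsilon:=b-\int_{|x|\le1}x\,(1-c_\varepsilon(x))\,\nu(dx),$$ $$L_\varepsilon g(y):=b_\varepsilon g'(y)+\tfrac{\sigma^2}{2}g''(y)+\int_{\mathbb R}\big\{g(y+x)-g(y)-x\,g'(y)\mathbf 1_{|x|\le1}\big\}\,c_\varepsilon(x)\,\nu(dx).$$ Let $\bar s_\varepsilon^{*1}:=\bar s_\varepsilon$ and $\bar s_\varepsilon^{*k}(x):=\int_{\mathbb R}\bar s_\varepsilon^{*(k-1)}(x-u)\,\bar s_\varepsilon(u)\,du$ for $k\ge2$, and, with $x_-:=\max(-x,0)$, $$\tilde h_{k,z}(y):=\int_{\mathbb R}\big(e^{z+y+u}-1\big)_-\,\bar s_\varepsilon^{*k}(u)\,du,\qquad \tilde c_j(z):=\sum_{k=1}^{j}\binom jk\,\big(L_\varepsilon^{\,j-k}\,\tilde h_{k,z}\big)(0).$$ Then these quantities are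 well defined: $(e^{z+Z_t}-1)_+$ is integrable for all $t\ge 0$ and $z\in\mathbb R$; and for all $z>z_0$, $k\ge 1$ and $q\ge 0$ the integral defining $\tilde h_{k,z}$ converges absolutely, $L_\varepsilon^{q}\tilde h_{k,z}$ is $C^\infty$ on $\mathbb R$, and the integral defining $L_\varepsilon\big(L_\varepsilon^{q}\tilde h_{k,z}\big)(y)$ converges absolutely for every $y$. Moreover there exist $t_0>0$ and $C<\infty$, not depending on $z$ or $t$, such that for all $z>z_0$ and $0<t<t_0$, $$\Big|\,G_t(z)-\Big(e^z-1+e^{-\lambda_\varepsilon t}\sum_{j=1}^{n}\tilde c_j(z)\,\frac{t^j}{j!}\Big)\Big|\le C\,t^{n+1}.$$ -/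

import Mathlib

open MeasureTheory ProbabilityTheory Filter Topology
open scoped NNReal ENNReal ContDiff

noncomputable section

namespace ExpLevy

/-- A Lévy measure on `ℝ`: no mass at the origin and `∫ min(1, z²) ν(dz) < ∞`. -/
structure IsLevyMeasure (ν : Measure ℝ) : Prop where
  zero_mass : ν {0} = 0
  integrable_min : Integrable (fun z : ℝ => min 1 (z ^ 2)) ν

/-- `z 1_{|z| ≤ 1}`. -/
def truncId (z : ℝ) : ℝ := if |z| ≤ 1 then z else 0

/-- The Lévy-Khintchine exponent of the triplet `(b, σ², ν)`, with truncation `1_{|z| ≤ 1}`. -/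
def levyExponent (b σ : ℝ) (ν : Measure ℝ) (u : ℝ) : ℂ :=
  Complex.I * b * u - (σ : ℂ) ^ 2 * (u : ℂ) ^ 2 / 2
    + ∫ z : ℝ, (Complex.exp (Complex.I * u * z) - 1 - Complex.I * u * truncId z) ∂ν

/-- A real-valued Lévy process: it starts at `0`, has independent and stationary increments, and
almost surely càdlàg paths. -/
structure IsLevyProcess {Ω : Type*} [MeasurableSpace Ω] (Z : ℝ≥0 → Ω → ℝ) (P : Measure Ω) :
    Prop where
  measurable : ∀ t, Measurable (Z t)
  start_zero : ∀ᵐ w ∂P, Z 0 w = 0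
  indep_increments : HasIndepIncrements Z P
  stationary_increments : ∀ s t, IdentDistrib (fun w => Z (s + t) w - Z s w) (Z t) P P
  cadlag : ∀ᵐ w ∂P, ∀ t : ℝ≥0, ContinuousWithinAt (fun r => Z r w) (Set.Ici t) t ∧
    ∃ l : ℝ, Tendsto (fun r => Z r w) (𝓝[<] t) (𝓝 l)

/-- `Z` is a Lévy process with generating triplet `(b, σ², ν)`. -/
structure IsLevyProcessWithTriplet {Ω : Type*} [MeasurableSpace Ω] (Z : ℝ≥0 → Ω → ℝ)
    (P : Measure Ω) (b σ : ℝ) (ν : Measure ℝ) : Prop where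
  levyMeasure : IsLevyMeasure ν
  levyProcess : IsLevyProcess Z P
  charFun_eq : ∀ (t : ℝ≥0) (u : ℝ),
    charFun (P.map (Z t)) u = Complex.exp ((t : ℝ) * levyExponent b σ ν u)

/-- `c` is a smooth symmetric truncation function with
`1_{[-ε/2, ε/2]} ≤ c ≤ 1_{[-ε, ε]}`. -/
structure IsTruncation (ε : ℝ) (c : ℝ → ℝ) : Prop where
  smooth : ContDiff ℝ ∞ c
  symmetric : ∀ z, c (-z) = c z
  lower : ∀ z, (Set.Icc (-(ε / 2)) (ε / 2)).indicator (fun _ => (1 : ℝ)) z ≤ c z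
  upper : ∀ z, c z ≤ (Set.Icc (-ε) ε).indicator (fun _ => (1 : ℝ)) z

/-- `ν(dz) = s(z) dz` with a nonnegative density `s`, smooth off the origin and with all
derivatives bounded away from every neighbourhood of the origin. -/
structure HasSmoothDensity (ν : Measure ℝ) (s : ℝ → ℝ) : Prop where
  nonneg : ∀ z, z ≠ 0 → 0 ≤ s z
  smooth : ContDiffOn ℝ ∞ s {0}ᶜ
  density : ν = volume.withDensity (fun z => ENNReal.ofReal (s z))
  bounded : ∀ (k : ℕ) (δ : ℝ), 0 < δ → ∃ M : ℝ, ∀ z : ℝ, δ < |z| → |iteratedDeriv k s z| ≤ M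

/-- `λ_ε = ∫ (1 - c_ε) dν`, the intensity of the large jumps. -/
def jumpIntensity (c : ℝ → ℝ) (ν : Measure ℝ) : ℝ := ∫ z, (1 - c z) ∂ν

/-- `s̄_ε = (1 - c_ε) s`. -/
def largeDensity (c s : ℝ → ℝ) (z : ℝ) : ℝ := (1 - c z) * s z

/-- The `k`-fold convolution power `f^{*k}` of a density, for `k ≥ 1`: `f^{*1} = f` and
`f^{*k}(x) = ∫ f^{*(k-1)}(x - u) f(u) du`. (The entry `k = 0` is a convention and is not used:
`f^{*0}` is the Dirac mass, which is not a function.) -/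
def convPow (f : ℝ → ℝ) : ℕ → ℝ → ℝ
  | 0 => fun _ => 0
  | 1 => f
  | (k + 2) => fun x => ∫ u, convPow f (k + 1) (x - u) * f u

/-- `b_ε = b - ∫_{|z| ≤ 1} z (1 - c_ε(z)) ν(dz)`. -/
def smallDrift (b : ℝ) (c : ℝ → ℝ) (ν : Measure ℝ) : ℝ :=
  b - ∫ z in Set.Icc (-1 : ℝ) 1, z * (1 - c z) ∂ν

/-- The integrand (with respect to `ν(dz)`) of the nonlocal part of `L_ε g (y)`. -/
def generatorIntegrand (c g : ℝ → ℝ) (y z : ℝ) : ℝ :=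
  (g (y + z) - g y - truncId z * deriv g y) * c z

/-- The generator `L_ε` of the Lévy process with triplet `(b_ε, σ², c_ε(z) ν(dz))`:
`L_ε g(y) = b_ε g'(y) + σ²/2 g''(y) + ∫ (g(y+z) - g(y) - z g'(y) 1_{|z| ≤ 1}) c_ε(z) ν(dz)`. -/
def smallGenerator (b σ : ℝ) (c : ℝ → ℝ) (ν : Measure ℝ) (g : ℝ → ℝ) (y : ℝ) : ℝ :=
  smallDrift b c ν * deriv g y + σ ^ 2 / 2 * iteratedDeriv 2 g y
    + ∫ z, generatorIntegrand c g y z ∂ν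

/-- `h̃_{k,z}(y) = ∫ (e^{z+y+u} - 1)_- s̄_ε^{*k}(u) du`, where `x_- = max(-x, 0)`. -/
def putSmoothed (c s : ℝ → ℝ) (k : ℕ) (z y : ℝ) : ℝ :=
  ∫ u, max (-(Real.exp (z + y + u) - 1)) 0 * convPow (largeDensity c s) k u

/-- `L_ε^q h̃_{k,z}`. -/
def iterCoeff (b σ : ℝ) (c s : ℝ → ℝ) (ν : Measure ℝ) (q k : ℕ) (z : ℝ) : ℝ → ℝ :=
  (smallGenerator b σ c ν)^[q] (putSmoothed c s k z)

/-- `c̃_j(z) = ∑_{k=1}^j binom(j,k) L_ε^{j-k} h̃_{k,z}(0)`. -/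
def itmCoeff (b σ : ℝ) (c s : ℝ → ℝ) (ν : Measure ℝ) (j : ℕ) (z : ℝ) : ℝ :=
  ∑ k ∈ Finset.Icc 1 j, (j.choose k : ℝ) * iterCoeff b σ c s ν (j - k) k z 0

/-- The call payoff `(e^{z + x} - 1)_+`. -/
def callPayoff (z x : ℝ) : ℝ := max (Real.exp (z + x) - 1) 0

/-- `G_t(z) = E (e^{z + Z_t} - 1)_+`. -/
def callPrice {Ω : Type*} [MeasurableSpace Ω] (P : Measure Ω) (Z : ℝ≥0 → Ω → ℝ)
    (t : ℝ≥0) (z : ℝ) : ℝ :=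
  ∫ w, callPayoff z (Z t w) ∂P

end ExpLevy

end

noncomputable section

set_option linter.unusedSectionVars false

namespace ExpLevy

/-! Since (e^w - 1)_+ = e^w - 1 + (e^w - 1)_- and the martingale condition gives E e^{Z_t} = 1, the
claim reduces to expanding E p(z + Z_t), where p(w) = (e^w - 1)_- is bounded. Heuristically, Z is
the sum of an independent small-jump process X, with generator L_ε, and a compound Poisson process
with jump measure (1 - c_ε)ν. Conditioning on the number k of large jumps gives e^{-λt} ∑_k (t^k/k!)
E F_k(z + X_t), with F_0 = p and F_k(y) = h̃_{k,0}(y) for k ≥ 1.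

The term k = 0 is a large deviation: p(w) ≤ e^{-rw} bounds it by e^{-rz} e^{tψ(-r)}, with ψ the
cumulant function of X. Taking r = (n+1)|log t|/z₀ makes the first factor at most t^{n+1}, while
tψ(-r) stays bounded because the jumps of X are at most ε < z₀/(n+1)
(`exists_exp_smallCumulant_le`). For 1 ≤ k ≤ n, F_k is bounded smooth, so E F_k(z + X_t) has a
Taylor expansion in t with coefficients L_ε^q F_k(z). Stopping at order n+1-k leaves an error
controlled by a sup norm, hence uniform in z. The terms k > n carry a factor t^{n+1}. Since
binom(j,k)/j! = 1/(k!(j-k)!), regrouping by powers of t yields c̃_j (`sum_Icc_choose_mul_eq`).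

No path decomposition is made, because only the law of Z_t matters. That law is the weak limit, as δ
→ 0, of convolutions of two compound Poisson laws (`tendsto_approxLaw`), in which X is replaced by a
compound Poisson process whose extra atoms imitate the drift and the Gaussian part (`jumpApprox`).
Expectations under compound Poisson laws are explicit power series in t, so the forward equation is
termwise differentiation (`hasDerivWithinAt_integral_compoundPoisson`). The approximate generator
differs from the true one by a multiple of `approxError`, which tends to 0
(`norm_integral_jumpApprox_sub_le`), so `abs_integral_compoundPoisson_sub_taylor_le` can be stated
with the limiting generator and constants free of δ, t and the base point. The identity E e^{Z_t} =
1 passes to the limit thanks to bounded second exponential moments (`lintegral_exp_eq_of_tendsto`).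
-/

/-! ### Bounded smooth functions and differentiation under the integral. -/

/-- `g` is smooth and all its derivatives are bounded. -/
def IsBddSmooth (g : ℝ → ℝ) : Prop :=
  ∃ G : ℕ → ℝ → ℝ, G 0 = g ∧ (∀ k x, HasDerivAt (G k) (G (k + 1) x) x) ∧
    ∀ k, ∃ M, ∀ x, |G k x| ≤ M

/-- Phrasing bounded smoothness through a chain of derivatives makes closure properties termwise
checks; this identification recovers the usual iterated derivatives from any such chain. -/
lemma iteratedDeriv_eq_of_chain {G : ℕ → ℝ → ℝ}
    (h : ∀ k x, HasDerivAt (G k) (G (k + 1) x) x) (k : ℕ) : iteratedDeriv k (G 0) = G k := by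
  induction k with
  | zero => simp
  | succ k ih => rw [iteratedDeriv_succ, ih]; funext x; exact (h k x).deriv

namespace IsBddSmooth

variable {g f : ℝ → ℝ}

lemma hasDerivAt_iteratedDeriv (hg : IsBddSmooth g) (k : ℕ) (x : ℝ) :
    HasDerivAt (iteratedDeriv k g) (iteratedDeriv (k + 1) g x) x := by
  obtain ⟨G, rfl, h, -⟩ := hg
  rw [iteratedDeriv_eq_of_chain h, iteratedDeriv_eq_of_chain h]
  exact h k x

lemma bounded_iteratedDeriv (hg : IsBddSmooth g) (k : ℕ) :
    ∃ M, 0 ≤ M ∧ ∀ x, |iteratedDeriv k g x| ≤ M := by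
  obtain ⟨G, rfl, h, hb⟩ := hg
  rw [iteratedDeriv_eq_of_chain h]
  obtain ⟨M, hM⟩ := hb k
  exact ⟨M, (abs_nonneg _).trans (hM 0), hM⟩

lemma hasDerivAt (hg : IsBddSmooth g) (x : ℝ) : HasDerivAt g (deriv g x) x := by
  simpa using hg.hasDerivAt_iteratedDeriv 0 x

lemma bounded (hg : IsBddSmooth g) : ∃ M, 0 ≤ M ∧ ∀ x, |g x| ≤ M := by
  simpa using hg.bounded_iteratedDeriv 0

lemma continuous (hg : IsBddSmooth g) : Continuous g :=
  continuous_iff_continuousAt.2 fun x => (hg.hasDerivAt x).continuousAt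

lemma iteratedDeriv (hg : IsBddSmooth g) (j : ℕ) : IsBddSmooth (iteratedDeriv j g) := by
  refine ⟨fun k => _root_.iteratedDeriv (j + k) g, by simp, fun k x =>
    hg.hasDerivAt_iteratedDeriv (j + k) x, fun k => ?_⟩
  obtain ⟨M, -, hM⟩ := hg.bounded_iteratedDeriv (j + k)
  exact ⟨M, hM⟩

lemma contDiff (hg : IsBddSmooth g) : ContDiff ℝ ∞ g := by
  refine contDiff_of_differentiable_iteratedDeriv fun m _ x => ?_
  exact (hg.hasDerivAt_iteratedDeriv m x).differentiableAt

lemma of_contDiff (hg : ContDiff ℝ ∞ g) (hb : ∀ k, ∃ M, ∀ x, |_root_.iteratedDeriv k g x| ≤ M) :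
    IsBddSmooth g := by
  refine ⟨fun k => _root_.iteratedDeriv k g, by simp, fun k x => ?_, hb⟩
  have := (hg.differentiable_iteratedDeriv k (by exact_mod_cast ENat.natCast_lt_top k)) x
  simpa only [iteratedDeriv_succ] using this.hasDerivAt

lemma add (hg : IsBddSmooth g) (hf : IsBddSmooth f) : IsBddSmooth (fun x => g x + f x) := by
  obtain ⟨G, rfl, h, hb⟩ := hg
  obtain ⟨F, rfl, h', hb'⟩ := hf
  refine ⟨fun k x => G k x + F k x, rfl, fun k x => (h k x).add (h' k x), fun k => ?_⟩
  obtain ⟨M, hM⟩ := hb k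
  obtain ⟨M', hM'⟩ := hb' k
  exact ⟨M + M', fun x => (abs_add_le _ _).trans (add_le_add (hM x) (hM' x))⟩

lemma const_mul (hg : IsBddSmooth g) (a : ℝ) : IsBddSmooth (fun x => a * g x) := by
  obtain ⟨G, rfl, h, hb⟩ := hg
  refine ⟨fun k x => a * G k x, rfl, fun k x => (h k x).const_mul a, fun k => ?_⟩
  obtain ⟨M, hM⟩ := hb k
  exact ⟨|a| * M, fun x => by rw [abs_mul]; gcongr; exact hM x⟩

lemma comp_const_add (hg : IsBddSmooth g) (a : ℝ) : IsBddSmooth (fun x => g (a + x)) := by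
  obtain ⟨G, rfl, h, hb⟩ := hg
  refine ⟨fun k x => G k (a + x), rfl, fun k x => (h k (a + x)).comp_const_add a x, fun k => ?_⟩
  obtain ⟨M, hM⟩ := hb k
  exact ⟨M, fun x => hM _⟩

/-- A function with a bounded smooth derivative is bounded smooth as soon as it is bounded. -/
lemma of_hasDerivAt (hf : IsBddSmooth f) (h : ∀ x, HasDerivAt g (f x) x)
    (hb : ∃ M, ∀ x, |g x| ≤ M) : IsBddSmooth g := by
  obtain ⟨F, rfl, h', hb'⟩ := hf
  refine ⟨fun k => Nat.casesOn k g F, rfl, fun k => ?_, fun k => ?_⟩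
  · cases k with
    | zero => exact h
    | succ k => exact h' k
  · cases k with
    | zero => exact hb
    | succ k => exact hb' k

end IsBddSmooth

/-- Differentiation under the integral sign, to all orders. -/
lemma isBddSmooth_integral {α : Type*} [MeasurableSpace α] {μ : Measure α}
    {K : ℕ → ℝ → α → ℝ} {w : α → ℝ} (hw : Integrable w μ)
    (hm : ∀ k y, AEStronglyMeasurable (K k y) μ)
    (hd : ∀ k y x, HasDerivAt (fun y => K k y x) (K (k + 1) y x) y)
    (hb : ∀ k, ∃ M, ∀ y x, |K k y x| ≤ M * w x) :
    IsBddSmooth (fun y => ∫ x, K 0 y x ∂μ) := by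
  refine ⟨fun k y => ∫ x, K k y x ∂μ, rfl, fun k y => ?_, fun k => ?_⟩
  · obtain ⟨M, hM⟩ := hb k
    obtain ⟨M', hM'⟩ := hb (k + 1)
    refine (hasDerivAt_integral_of_dominated_loc_of_deriv_le (F := K k) (F' := K (k + 1))
      (bound := fun x => M' * w x) (s := Set.univ) univ_mem (Eventually.of_forall fun y => hm k y)
      ((hw.const_mul M).mono' (hm k y) (Eventually.of_forall fun x => hM y x)) (hm (k + 1) y)
      (Eventually.of_forall fun x y _ => hM' y x) (hw.const_mul M')
      (Eventually.of_forall fun x y _ => hd k y x)).2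
  · obtain ⟨M, hM⟩ := hb k
    refine ⟨∫ x, M * w x ∂μ, fun y => ?_⟩
    exact norm_integral_le_of_norm_le (f := K k y) (hw.const_mul M)
      (Eventually.of_forall fun x => hM y x)

/-- The convolution of an integrable function with a bounded smooth function. -/
lemma IsBddSmooth.integral_comp_sub {g f : ℝ → ℝ} (hg : IsBddSmooth g) (hf : Integrable f) :
    IsBddSmooth (fun x => ∫ u, g (x - u) * f u) := by
  obtain ⟨G, rfl, h, hb⟩ := hg
  have hc : ∀ k, Continuous (G k) := fun k =>
    continuous_iff_continuousAt.2 fun x => (h k x).continuousAt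
  refine isBddSmooth_integral (K := fun k x u => G k (x - u) * f u) (w := fun u => |f u|) hf.abs
    (fun k y => (((hc k).comp (by fun_prop)).aestronglyMeasurable).mul hf.1)
    (fun k y x => ((h k (y - x)).comp_sub_const y x).mul_const _) (fun k => ?_)
  obtain ⟨M, hM⟩ := hb k
  exact ⟨M, fun y x => by rw [abs_mul]; gcongr; exact hM _⟩

/-! ### Taylor bounds at the origin. -/

section Taylor

variable {E : Type*} [NormedAddCommGroup E] [NormedSpace ℝ E] {φ φ₁ φ₂ φ₃ : ℝ → E} {R M : ℝ}

lemma norm_sub_le_of_hasDerivAt (h : ∀ x, |x| ≤ R → HasDerivAt φ (φ₁ x) x) {x : ℝ} (hx : |x| ≤ R)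
    (hM : ∀ y, |y| ≤ |x| → ‖φ₁ y‖ ≤ M) : ‖φ x - φ 0‖ ≤ M * |x| := by
  have hs : ∀ y ∈ Set.uIcc 0 x, |y| ≤ |x| := fun y hy => by
    simpa using Set.abs_sub_left_of_mem_uIcc hy
  have := Convex.norm_image_sub_le_of_norm_hasDerivWithin_le (s := Set.uIcc 0 x) (f := φ)
    (f' := φ₁) (C := M) (x := 0) (y := x)
    (fun y hy => (h y ((hs y hy).trans hx)).hasDerivWithinAt)
    (fun y hy => hM y (hs y hy)) (convex_uIcc _ _) Set.left_mem_uIcc Set.right_mem_uIcc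
  simpa using this

/-- The mean value inequality applied to φ minus its Taylor polynomial; the constant is not sharp.
Hypotheses are restricted to a ball and values lie in a normed space so that real and complex
exponentials, unbounded on the whole line in the real case, are covered too. -/
lemma norm_taylor_one_le (h : ∀ x, |x| ≤ R → HasDerivAt φ (φ₁ x) x)
    (h₁ : ∀ x, |x| ≤ R → HasDerivAt φ₁ (φ₂ x) x) (hM : ∀ x, |x| ≤ R → ‖φ₂ x‖ ≤ M)
    {x : ℝ} (hx : |x| ≤ R) : ‖φ x - φ 0 - x • φ₁ 0‖ ≤ M * x ^ 2 := by
  have := norm_sub_le_of_hasDerivAt (φ := fun y => φ y - y • φ₁ 0) (φ₁ := fun y => φ₁ y - φ₁ 0)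
    (R := R) (M := M * |x|)
    (fun y hy => by simpa using (h y hy).fun_sub ((hasDerivAt_id y).smul_const (φ₁ 0))) hx
    (fun y hy => (norm_sub_le_of_hasDerivAt h₁ (hy.trans hx)
      (fun w hw => hM w (hw.trans (hy.trans hx)))).trans (by
        have : 0 ≤ M := (norm_nonneg _).trans (hM x hx)
        gcongr))
  have h2 : M * |x| * |x| = M * x ^ 2 := by rw [mul_assoc, ← sq, sq_abs]
  rw [h2] at this
  convert this using 2
  simp; abel

lemma norm_taylor_two_le (h : ∀ x, |x| ≤ R → HasDerivAt φ (φ₁ x) x)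
    (h₁ : ∀ x, |x| ≤ R → HasDerivAt φ₁ (φ₂ x) x) (h₂ : ∀ x, |x| ≤ R → HasDerivAt φ₂ (φ₃ x) x)
    (hM : ∀ x, |x| ≤ R → ‖φ₃ x‖ ≤ M)
    {x : ℝ} (hx : |x| ≤ R) :
    ‖φ x - φ 0 - x • φ₁ 0 - (x ^ 2 / 2) • φ₂ 0‖ ≤ M * |x| ^ 3 := by
  have := norm_sub_le_of_hasDerivAt (φ := fun y => φ y - y • φ₁ 0 - (y ^ 2 / 2) • φ₂ 0)
    (φ₁ := fun y => φ₁ y - φ₁ 0 - y • φ₂ 0)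
    (R := R) (M := M * x ^ 2)
    (fun y hy => by
      have h3 : HasDerivAt (fun y : ℝ => y ^ 2 / 2) y y := by
        simpa using (hasDerivAt_pow 2 y).div_const 2
      simpa using ((h y hy).fun_sub ((hasDerivAt_id y).smul_const (φ₁ 0))).fun_sub (h3.smul_const (φ₂ 0)))
    hx
    (fun y hy => (norm_taylor_one_le h₁ h₂ hM (hy.trans hx)).trans (by
        have : 0 ≤ M := (norm_nonneg _).trans (hM x hx)
        exact mul_le_mul_of_nonneg_left (sq_le_sq.2 hy) this))
  have h2 : M * x ^ 2 * |x| = M * |x| ^ 3 := by rw [← sq_abs]; ring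
  rw [h2] at this
  convert this using 2
  simp; abel

end Taylor

/-! ### The generator on bounded smooth functions. -/

/-- The generator of the Lévy process with drift `β`, Gaussian part `σ²` and small jumps given by
the measure `γ`. -/
def levyGenerator (β σ : ℝ) (γ : Measure ℝ) (g : ℝ → ℝ) (y : ℝ) : ℝ :=
  β * deriv g y + σ ^ 2 / 2 * iteratedDeriv 2 g y + ∫ x, (g (y + x) - g y - x * deriv g y) ∂γ

/-- Uniformity in y and validity at every order k provide the dominating function M x² needed to
differentiate the nonlocal part of the generator repeatedly. -/
lemma IsBddSmooth.abs_taylor_le {g : ℝ → ℝ} (hg : IsBddSmooth g) (k : ℕ) :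
    ∃ M, ∀ y x, |_root_.iteratedDeriv k g (y + x) - _root_.iteratedDeriv k g y
      - x * _root_.iteratedDeriv (k + 1) g y| ≤ M * x ^ 2 := by
  obtain ⟨M, -, hM⟩ := hg.bounded_iteratedDeriv (k + 2)
  refine ⟨M, fun y x => ?_⟩
  simpa using norm_taylor_one_le (φ := fun x => _root_.iteratedDeriv k g (y + x))
    (R := |x|)
    (fun x _ => (hg.hasDerivAt_iteratedDeriv k (y + x)).comp_const_add y x)
    (fun x _ => (hg.hasDerivAt_iteratedDeriv (k + 1) (y + x)).comp_const_add y x)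
    (fun x _ => hM (y + x)) le_rfl

lemma IsBddSmooth.integrable_taylor {g : ℝ → ℝ} (hg : IsBddSmooth g) {γ : Measure ℝ}
    (hγ : Integrable (fun x : ℝ => x ^ 2) γ) (y : ℝ) :
    Integrable (fun x => g (y + x) - g y - x * deriv g y) γ := by
  obtain ⟨M, hM⟩ := hg.abs_taylor_le 0
  have hc := hg.continuous
  refine (hγ.const_mul M).mono' (by fun_prop) (Eventually.of_forall fun x => ?_)
  simpa using hM y x

/-- Stability of the class under the generator is what makes all its iterates meaningful and
bounded. -/
lemma IsBddSmooth.levyGenerator {g : ℝ → ℝ} (hg : IsBddSmooth g) (β σ : ℝ) {γ : Measure ℝ}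
    (hγ : Integrable (fun x : ℝ => x ^ 2) γ) : IsBddSmooth (levyGenerator β σ γ g) := by
  have h1 : IsBddSmooth (deriv g) := by simpa using hg.iteratedDeriv 1
  refine ((h1.const_mul β).add ((hg.iteratedDeriv 2).const_mul (σ ^ 2 / 2))).add ?_
  have := isBddSmooth_integral (μ := γ) (w := fun x => x ^ 2)
    (K := fun k y x => _root_.iteratedDeriv k g (y + x) - _root_.iteratedDeriv k g y
      - x * _root_.iteratedDeriv (k + 1) g y) hγ
    (fun k y => by
      have := (hg.iteratedDeriv k).continuous
      fun_prop)
    (fun k y x => (((hg.hasDerivAt_iteratedDeriv k (y + x)).comp_add_const y x).sub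
      (hg.hasDerivAt_iteratedDeriv k y)).sub
      ((hg.hasDerivAt_iteratedDeriv (k + 1) y).const_mul x))
    (fun k => hg.abs_taylor_le k)
  simpa using this

/-! ### Compound Poisson laws and their forward equation. -/

/-- The convolution powers of a measure. -/
def convPowMeasure (η : Measure ℝ) : ℕ → Measure ℝ
  | 0 => Measure.dirac 0
  | k + 1 => (convPowMeasure η k).conv η

/-- The compound Poisson distribution at time `t` with jump measure `η`. -/
def compoundPoisson (η : Measure ℝ) (t : ℝ) : Measure ℝ :=
  ENNReal.ofReal (Real.exp (-(t * η.real Set.univ))) •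
    Measure.sum fun k : ℕ => ENNReal.ofReal (t ^ k / k.factorial) • convPowMeasure η k

section

variable {η : Measure ℝ} [IsFiniteMeasure η]

instance isFiniteMeasure_convPowMeasure (k : ℕ) : IsFiniteMeasure (convPowMeasure η k) := by
  induction k with
  | zero => rw [convPowMeasure]; infer_instance
  | succ k ih => rw [convPowMeasure]; infer_instance

lemma lintegral_convPowMeasure_succ (k : ℕ) {f : ℝ → ℝ≥0∞} (hf : Measurable f) :
    ∫⁻ x, f x ∂convPowMeasure η (k + 1) = ∫⁻ x, ∫⁻ y, f (x + y) ∂η ∂convPowMeasure η k := by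
  rw [convPowMeasure, Measure.lintegral_conv hf]

lemma lintegral_exp_convPowMeasure (r : ℝ) (k : ℕ) :
    ∫⁻ x, ENNReal.ofReal (Real.exp (r * x)) ∂convPowMeasure η k
      = (∫⁻ x, ENNReal.ofReal (Real.exp (r * x)) ∂η) ^ k := by
  induction k with
  | zero => simp [convPowMeasure]
  | succ k ih =>
    rw [lintegral_convPowMeasure_succ k (by fun_prop)]
    simp_rw [mul_add, Real.exp_add, ENNReal.ofReal_mul (Real.exp_pos _).le]
    have : ∀ x : ℝ, ∫⁻ y, ENNReal.ofReal (Real.exp (r * x)) * ENNReal.ofReal (Real.exp (r * y)) ∂η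
        = ENNReal.ofReal (Real.exp (r * x)) * ∫⁻ y, ENNReal.ofReal (Real.exp (r * y)) ∂η :=
      fun x => lintegral_const_mul _ (by fun_prop)
    simp_rw [this]
    rw [lintegral_mul_const _ (by fun_prop), ih, pow_succ]

lemma measureReal_convPowMeasure (k : ℕ) :
    (convPowMeasure η k).real Set.univ = η.real Set.univ ^ k := by
  have := lintegral_exp_convPowMeasure (η := η) 0 k
  simp only [zero_mul, Real.exp_zero, ENNReal.ofReal_one, lintegral_one] at this
  rw [Measure.real, this, ENNReal.toReal_pow, Measure.real]

lemma lintegral_compoundPoisson (t : ℝ) (f : ℝ → ℝ≥0∞) :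
    ∫⁻ x, f x ∂compoundPoisson η t = ENNReal.ofReal (Real.exp (-(t * η.real Set.univ))) *
      ∑' k : ℕ, ENNReal.ofReal (t ^ k / k.factorial) * ∫⁻ x, f x ∂convPowMeasure η k := by
  simp [compoundPoisson, lintegral_sum_measure]

/-- Exponential moments of convolution powers are powers, so the series sums to an exponential. The
lower integral yields integrability together with the value, and r = 0 gives total mass one. -/
lemma lintegral_exp_compoundPoisson {t r : ℝ} (ht : 0 ≤ t)
    (hr : Integrable (fun x => Real.exp (r * x)) η) :
    ∫⁻ x, ENNReal.ofReal (Real.exp (r * x)) ∂compoundPoisson η t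
      = ENNReal.ofReal (Real.exp (t * ∫ x, (Real.exp (r * x) - 1) ∂η)) := by
  set a := ∫ x, Real.exp (r * x) ∂η with ha
  have ha0 : 0 ≤ a := integral_nonneg fun x => (Real.exp_pos _).le
  have h1 : ∫⁻ x, ENNReal.ofReal (Real.exp (r * x)) ∂η = ENNReal.ofReal a :=
    (ofReal_integral_eq_lintegral_ofReal hr
      (Eventually.of_forall fun x => (Real.exp_pos _).le)).symm
  have h2 : HasSum (fun k : ℕ => (t * a) ^ k / (k.factorial : ℝ)) (Real.exp (t * a)) := by
    rw [Real.exp_eq_exp_ℝ]; exact NormedSpace.expSeries_div_hasSum_exp (t * a)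
  rw [lintegral_compoundPoisson]
  have h3 : ∀ k : ℕ, ENNReal.ofReal (t ^ k / k.factorial) *
      ∫⁻ x, ENNReal.ofReal (Real.exp (r * x)) ∂convPowMeasure η k
      = ENNReal.ofReal ((t * a) ^ k / (k.factorial : ℝ)) := fun k => by
    rw [lintegral_exp_convPowMeasure, h1, ← ENNReal.ofReal_pow ha0,
      ← ENNReal.ofReal_mul (by positivity)]
    congr 1; ring
  simp_rw [h3]
  rw [← ENNReal.ofReal_tsum_of_nonneg (fun k => by positivity) h2.summable, h2.tsum_eq,
    ← ENNReal.ofReal_mul (Real.exp_pos _).le, ← Real.exp_add]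
  congr 2
  rw [integral_sub hr (integrable_const _)]
  simp only [integral_const, smul_eq_mul, mul_one, ← ha]
  ring

lemma isProbabilityMeasure_compoundPoisson {t : ℝ} (ht : 0 ≤ t) :
    IsProbabilityMeasure (compoundPoisson η t) := by
  constructor
  have := lintegral_exp_compoundPoisson (η := η) (r := 0) ht (by simp)
  simpa using this

variable {E : Type*} [NormedAddCommGroup E] [NormedSpace ℝ E]

lemma norm_integral_convPowMeasure_le {f : ℝ → E} {M : ℝ} (hM : ∀ x, ‖f x‖ ≤ M) (k : ℕ) :
    ‖∫ x, f x ∂convPowMeasure η k‖ ≤ M * η.real Set.univ ^ k := by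
  rw [← measureReal_convPowMeasure]
  exact norm_integral_le_of_norm_le_const (Eventually.of_forall hM)

lemma hasSum_integral_compoundPoisson {t : ℝ} (ht : 0 ≤ t) {f : ℝ → E}
    (hf : Integrable f (compoundPoisson η t)) :
    HasSum (fun k : ℕ => (Real.exp (-(t * η.real Set.univ)) * (t ^ k / k.factorial)) •
      ∫ x, f x ∂convPowMeasure η k) (∫ x, f x ∂compoundPoisson η t) := by
  have hc : ENNReal.ofReal (Real.exp (-(t * η.real Set.univ))) ≠ 0 := by
    simp [Real.exp_pos]
  rw [compoundPoisson, integrable_smul_measure hc ENNReal.ofReal_ne_top] at hf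
  have := (hasSum_integral_measure hf).const_smul (Real.exp (-(t * η.real Set.univ)))
  rw [compoundPoisson, integral_smul_measure, ENNReal.toReal_ofReal (Real.exp_pos _).le]
  convert this using 2 with k
  rw [integral_smul_measure, ENNReal.toReal_ofReal (by positivity), mul_smul]

lemma integrable_compoundPoisson {t : ℝ} (ht : 0 ≤ t) {f : ℝ → E} (hf : StronglyMeasurable f)
    {M : ℝ} (hM : ∀ x, ‖f x‖ ≤ M) : Integrable f (compoundPoisson η t) := by
  have := isProbabilityMeasure_compoundPoisson (η := η) ht
  exact Integrable.of_bound hf.aestronglyMeasurable M (Eventually.of_forall hM)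

lemma charFun_convPowMeasure (u : ℝ) (k : ℕ) :
    charFun (convPowMeasure η k) u = charFun η u ^ k := by
  induction k with
  | zero => simp [convPowMeasure, charFun_apply_real]
  | succ k ih => rw [convPowMeasure, charFun_conv, ih, pow_succ]

lemma charFun_compoundPoisson {t : ℝ} (ht : 0 ≤ t) (u : ℝ) :
    charFun (compoundPoisson η t) u
      = Complex.exp (t * ∫ x, (Complex.exp (u * x * Complex.I) - 1) ∂η) := by
  have hi : Integrable (fun x : ℝ => Complex.exp (u * x * Complex.I)) η := by
    refine Integrable.of_bound (by fun_prop) 1 (Eventually.of_forall fun x => ?_)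
    rw [← Complex.ofReal_mul, Complex.norm_exp_ofReal_mul_I]
  have h1 : StronglyMeasurable (fun x : ℝ => Complex.exp (u * x * Complex.I)) := by fun_prop
  have h2 := hasSum_integral_compoundPoisson ht (integrable_compoundPoisson (η := η) ht h1 (M := 1)
    fun x => by rw [← Complex.ofReal_mul, Complex.norm_exp_ofReal_mul_I])
  simp_rw [← charFun_apply_real, charFun_convPowMeasure] at h2
  have h3 : HasSum (fun k : ℕ => (t * charFun η u) ^ k / (k.factorial : ℂ))
      (Complex.exp (t * charFun η u)) := by
    rw [Complex.exp_eq_exp_ℂ]; exact NormedSpace.expSeries_div_hasSum_exp (t * charFun η u)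
  have h4 := h3.mul_left (Complex.exp (-(t * η.real Set.univ)))
  rw [integral_sub hi (integrable_const _), ← charFun_apply_real]
  have h6 : (fun k : ℕ => (Real.exp (-(t * η.real Set.univ)) * (t ^ k / k.factorial)) •
      charFun η u ^ k) = fun k : ℕ => Complex.exp (-(↑t * ↑(η.real Set.univ))) *
        ((↑t * charFun η u) ^ k / ↑k.factorial) := by
    funext k; rw [Complex.real_smul]; push_cast; ring
  have h5 := h2.unique (h6 ▸ h4)
  rw [h5, ← Complex.exp_add]
  congr 1
  simp; ring

/-- Exponential generating series can be differentiated termwise. -/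
lemma hasDerivAt_tsum_pow_div_factorial {a : ℕ → ℝ} {M Λ : ℝ} (_ : 0 ≤ Λ)
    (ha : ∀ k, |a k| ≤ M * Λ ^ k) (t : ℝ) :
    HasDerivAt (fun t : ℝ => ∑' k : ℕ, t ^ k / k.factorial * a k)
      (∑' k : ℕ, t ^ k / k.factorial * a (k + 1)) t := by
  have hs : ∀ x : ℝ, Summable fun k : ℕ => x ^ k / (k.factorial : ℝ) :=
    Real.summable_pow_div_factorial
  set T := |t| + 1 with hT
  have e : ∀ (x : ℝ) (k : ℕ), ((k + 1 : ℕ) : ℝ) * x ^ (k + 1 - 1) / (k + 1).factorial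
      = x ^ k / k.factorial := fun x k => by
    rw [Nat.factorial_succ]
    have : (k.factorial : ℝ) ≠ 0 := by positivity
    have : ((k : ℝ) + 1) ≠ 0 := by positivity
    push_cast; field_simp
  have hu : Summable fun k : ℕ => (k : ℝ) * T ^ (k - 1) / k.factorial * (M * Λ ^ k) := by
    -- The shift absorbs the factor k into the factorial and leaves an exponential series in TΛ.
    rw [← summable_nat_add_iff 1]
    refine ((hs (T * Λ)).mul_left (M * Λ)).congr fun k => ?_
    rw [e, mul_pow]; ring
  have hle : ∀ (k : ℕ) (x : ℝ), |x| ≤ T →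
      |(k : ℝ) * x ^ (k - 1) / k.factorial * a k| ≤ k * T ^ (k - 1) / k.factorial * (M * Λ ^ k) :=
    fun k x hx => by
      rw [abs_mul, abs_div, abs_mul, abs_pow, Nat.abs_cast, Nat.abs_cast]
      gcongr
      exact ha k
  have key := hasDerivAt_tsum_of_isPreconnected (𝕜 := ℝ) (F := ℝ)
    (g := fun (k : ℕ) (x : ℝ) => x ^ k / k.factorial * a k)
    (g' := fun (k : ℕ) x => k * x ^ (k - 1) / k.factorial * a k)
    (u := fun k : ℕ => k * T ^ (k - 1) / k.factorial * (M * Λ ^ k))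
    (t := Metric.ball 0 T) (y₀ := 0) (y := t) hu
    Metric.isOpen_ball (convex_ball _ _).isPreconnected
    (fun k x _ => by
      simpa using ((hasDerivAt_pow k x).div_const (k.factorial : ℝ)).mul_const (a k))
    (fun k x hx => hle k x (by
      have := Metric.mem_ball.1 hx
      rw [Real.dist_eq, sub_zero] at this; exact this.le))
    (by simp [hT]; positivity)
    (summable_of_ne_finset_zero (s := {0}) fun k hk => by simp_all)
    (by simp [hT])
  have h6 : Summable fun k : ℕ => (k : ℝ) * t ^ (k - 1) / k.factorial * a k :=
    Summable.of_norm_bounded hu fun k => hle k t (by simp [hT])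
  have h7 := h6.tsum_eq_zero_add
  simp only [Nat.cast_zero, zero_mul, zero_div, zero_add, e] at h7
  rwa [h7] at key

lemma integral_convPowMeasure_succ {f : ℝ → ℝ} (hf : Continuous f) {M : ℝ}
    (hM : ∀ x, |f x| ≤ M) (k : ℕ) :
    ∫ x, f x ∂convPowMeasure η (k + 1) = ∫ x, ∫ y, f (x + y) ∂η ∂convPowMeasure η k := by
  rw [convPowMeasure, integral_conv]
  exact Integrable.of_bound hf.aestronglyMeasurable M (Eventually.of_forall hM)

/-- The forward equation of a compound Poisson process. -/
lemma hasDerivWithinAt_integral_compoundPoisson {f : ℝ → ℝ} (hf : Continuous f) {M : ℝ}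
    (hM : ∀ x, |f x| ≤ M) {t : ℝ} (ht : 0 ≤ t) :
    HasDerivWithinAt (fun t => ∫ x, f x ∂compoundPoisson η t)
      (∫ x, ∫ y, (f (x + y) - f x) ∂η ∂compoundPoisson η t) (Set.Ici 0) t := by
  set Λ := η.real Set.univ with hΛ
  set a : ℕ → ℝ := fun k => ∫ x, f x ∂convPowMeasure η k with ha
  have hb : ∀ k, |a k| ≤ M * Λ ^ k := fun k => norm_integral_convPowMeasure_le (f := f) hM k
  have hfi : ∀ x, Integrable (fun y => f (x + y)) η := fun x =>
    Integrable.of_bound (by fun_prop) M (Eventually.of_forall fun y => hM _)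
  have hsm : StronglyMeasurable fun x => ∫ y, f (x + y) ∂η :=
    (Continuous.stronglyMeasurable (f := fun p : ℝ × ℝ => f (p.1 + p.2))
      (by fun_prop)).integral_prod_right
  have hbd : ∀ x, |∫ y, f (x + y) ∂η| ≤ M * Λ := fun x =>
    norm_integral_le_of_norm_le_const (f := fun y => f (x + y))
      (Eventually.of_forall fun y => hM _)
  have e1 : ∀ x, ∫ y, (f (x + y) - f x) ∂η = (∫ y, f (x + y) ∂η) - Λ * f x := fun x => by
    rw [integral_sub (hfi x) (integrable_const _)]; simp [hΛ]
  have hser : ∀ s ∈ Set.Ici (0 : ℝ), ∫ x, f x ∂compoundPoisson η s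
      = Real.exp (-(s * Λ)) * ∑' k : ℕ, s ^ k / k.factorial * a k := fun s hs => by
    rw [← (hasSum_integral_compoundPoisson hs (integrable_compoundPoisson hs
      hf.stronglyMeasurable hM)).tsum_eq, ← tsum_mul_left]
    exact tsum_congr fun k => by simp only [smul_eq_mul, mul_assoc]; rfl
  have hder : ∫ x, ∫ y, (f (x + y) - f x) ∂η ∂compoundPoisson η t
      = (-Λ * Real.exp (-(t * Λ))) * (∑' k : ℕ, t ^ k / k.factorial * a k)
        + Real.exp (-(t * Λ)) * ∑' k : ℕ, t ^ k / k.factorial * a (k + 1) := by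
    simp_rw [e1]
    rw [integral_sub (integrable_compoundPoisson ht hsm hbd)
      ((integrable_compoundPoisson ht hf.stronglyMeasurable hM).const_mul Λ),
      integral_const_mul, hser t ht,
      ← (hasSum_integral_compoundPoisson ht (integrable_compoundPoisson ht hsm hbd)).tsum_eq]
    simp_rw [← integral_convPowMeasure_succ hf hM, smul_eq_mul, mul_assoc]
    rw [tsum_mul_left]
    ring
  rw [hder]
  have h1 : HasDerivAt (fun s : ℝ => Real.exp (-(s * Λ))) (-Λ * Real.exp (-(t * Λ))) t := by
    have := ((hasDerivAt_id t).mul_const Λ).neg.exp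
    simpa [mul_comm] using this
  exact ((h1.mul (hasDerivAt_tsum_pow_div_factorial measureReal_nonneg hb t)).hasDerivWithinAt).congr hser
    (hser t ht)

end

/-! ### Approximating drift, Gaussian part and small jumps by finitely many jumps per unit time. -/

/-- The drift left when the jumps larger than `δ` are no longer compensated. -/
def driftApprox (β : ℝ) (γ : Measure ℝ) (δ : ℝ) : ℝ := β - ∫ x in {x | δ < |x|}, x ∂γ

/-- A finite jump measure whose compound Poisson process approximates the Lévy process with
triplet `(β, σ², γ)`. -/
def jumpApprox (β σ : ℝ) (γ : Measure ℝ) (δ : ℝ) : Measure ℝ :=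
  γ.restrict {x | δ < |x|} +
    (ENNReal.ofReal ((δ ^ 3)⁻¹) • Measure.dirac (driftApprox β γ δ * δ ^ 3) +
      ENNReal.ofReal ((2 * δ ^ 2)⁻¹) • (Measure.dirac (σ * δ) + Measure.dirac (-(σ * δ))))

/-- The rate of approximation by `jumpApprox`. -/
def approxError (β σ : ℝ) (γ : Measure ℝ) (δ : ℝ) : ℝ :=
  driftApprox β γ δ ^ 2 * δ ^ 3 + |σ| ^ 3 * δ + ∫ x in {x | |x| ≤ δ}, x ^ 2 ∂γ

/-- A radius that contains all the atoms used by `jumpApprox`. -/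
def approxRadius (β σ : ℝ) (γ : Measure ℝ) : ℝ := 1 + |σ| + |β| + ∫ x, x ^ 2 ∂γ

section

variable {β σ δ : ℝ} {γ : Measure ℝ}

lemma measurableSet_lt_abs (δ : ℝ) : MeasurableSet {x : ℝ | δ < |x|} :=
  measurableSet_lt measurable_const (by fun_prop)

lemma measurableSet_abs_le (δ : ℝ) : MeasurableSet {x : ℝ | |x| ≤ δ} :=
  measurableSet_le (by fun_prop) measurable_const

lemma measure_lt_abs_lt_top (hγ : Integrable (fun x : ℝ => x ^ 2) γ) (hδ : 0 < δ) :
    γ {x | δ < |x|} < ⊤ := by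
  refine (measure_mono fun x (hx : δ < |x|) => ?_).trans_lt
    (hγ.measure_ge_lt_top (ε := δ ^ 2) (by positivity))
  show δ ^ 2 ≤ x ^ 2
  rw [← sq_abs x]
  gcongr

lemma isFiniteMeasure_jumpApprox (hγ : Integrable (fun x : ℝ => x ^ 2) γ) (hδ : 0 < δ) :
    IsFiniteMeasure (jumpApprox β σ γ δ) := by
  have : IsFiniteMeasure (γ.restrict {x | δ < |x|}) :=
    ⟨by rw [Measure.restrict_apply_univ]; exact measure_lt_abs_lt_top hγ hδ⟩
  have h2 : ∀ (a : ℝ) (μ : Measure ℝ) [IsFiniteMeasure μ],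
      IsFiniteMeasure (ENNReal.ofReal a • μ) := fun a μ _ =>
    Measure.smul_finite μ ENNReal.ofReal_ne_top
  unfold jumpApprox
  have := h2 (δ ^ 3)⁻¹ (Measure.dirac (driftApprox β γ δ * δ ^ 3))
  have := h2 (2 * δ ^ 2)⁻¹ (Measure.dirac (σ * δ) + Measure.dirac (-(σ * δ)))
  infer_instance

lemma integrableOn_id_of_sq (hγ : Integrable (fun x : ℝ => x ^ 2) γ) (hδ : 0 < δ) :
    IntegrableOn (fun x => x) {x | δ < |x|} γ := by
  refine Integrable.mono' (hγ.integrableOn.const_mul δ⁻¹) (by fun_prop) ?_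
  refine (ae_restrict_iff' (measurableSet_lt_abs δ)).2 (Eventually.of_forall fun x hx => ?_)
  have hx : δ < |x| := hx
  rw [Real.norm_eq_abs, ← sq_abs x, inv_mul_eq_div, le_div_iff₀ hδ, sq]
  gcongr

/-- On δ < |x| one has |x| ≤ x²/δ. The drift may therefore grow like 1/δ, which is why its atom in
`jumpApprox` has size of order δ³ times the drift. -/
lemma abs_driftApprox_le (hγ : Integrable (fun x : ℝ => x ^ 2) γ) (hδ : 0 < δ) :
    |driftApprox β γ δ| ≤ |β| + (∫ x, x ^ 2 ∂γ) / δ := by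
  refine (abs_sub _ _).trans (add_le_add le_rfl ?_)
  have h1 : ‖∫ x in {x | δ < |x|}, x ∂γ‖ ≤ ∫ x in {x | δ < |x|}, δ⁻¹ * x ^ 2 ∂γ := by
    refine norm_integral_le_of_norm_le (hγ.integrableOn.const_mul δ⁻¹) ?_
    refine (ae_restrict_iff' (measurableSet_lt_abs δ)).2 (Eventually.of_forall fun x hx => ?_)
    have hx : δ < |x| := hx
    rw [Real.norm_eq_abs, ← sq_abs x, inv_mul_eq_div, le_div_iff₀ hδ, sq]
    gcongr
  refine h1.trans ?_
  rw [integral_const_mul, inv_mul_eq_div]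
  have := setIntegral_le_integral (s := {x | δ < |x|}) hγ (Eventually.of_forall fun x => sq_nonneg x)
  gcongr

lemma abs_driftApprox_mul_le (hγ : Integrable (fun x : ℝ => x ^ 2) γ) (hδ : 0 < δ) (hδ1 : δ ≤ 1) :
    |driftApprox β γ δ| * δ ≤ |β| + ∫ x, x ^ 2 ∂γ := by
  have h := mul_le_mul_of_nonneg_right (abs_driftApprox_le (β := β) hγ hδ) hδ.le
  rw [add_mul, div_mul_cancel₀ _ hδ.ne'] at h
  have : |β| * δ ≤ |β| := mul_le_of_le_one_right (abs_nonneg _) hδ1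
  linarith

lemma approxError_nonneg (hδ : 0 < δ) : 0 ≤ approxError β σ γ δ := by
  have : 0 ≤ ∫ x in {x | |x| ≤ δ}, x ^ 2 ∂γ := integral_nonneg fun x => sq_nonneg x
  unfold approxError
  positivity

/-- The drift contribution is (|drift| δ)² δ with |drift| δ bounded; the small-jump contribution
vanishes by dominated convergence, since the integrand x² is zero at the origin. -/
lemma tendsto_approxError (hγ : Integrable (fun x : ℝ => x ^ 2) γ) {d : ℕ → ℝ}
    (hd : ∀ m, 0 < d m ∧ d m ≤ 1) (hd0 : Tendsto d atTop (𝓝 0)) :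
    Tendsto (fun m => approxError β σ γ (d m)) atTop (𝓝 0) := by
  have h1 : Tendsto (fun m => driftApprox β γ (d m) ^ 2 * d m ^ 3) atTop (𝓝 0) := by
    have h2 : Tendsto (fun m => (|β| + ∫ x, x ^ 2 ∂γ) ^ 2 * d m) atTop (𝓝 0) := by
      simpa using hd0.const_mul ((|β| + ∫ x, x ^ 2 ∂γ) ^ 2)
    refine squeeze_zero (fun m => ?_) (fun m => ?_) h2
    · have := (hd m).1; positivity
    · have h3 := abs_driftApprox_mul_le (β := β) hγ (hd m).1 (hd m).2
      have h4 : driftApprox β γ (d m) ^ 2 * d m ^ 3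
          = (|driftApprox β γ (d m)| * d m) ^ 2 * d m := by rw [mul_pow, sq_abs]; ring
      rw [h4]
      have := (hd m).1
      gcongr
  have h2 : Tendsto (fun m => |σ| ^ 3 * d m) atTop (𝓝 0) := by simpa using hd0.const_mul (|σ| ^ 3)
  have h3 : Tendsto (fun m => ∫ x in {x | |x| ≤ d m}, x ^ 2 ∂γ) atTop (𝓝 0) := by
    simp_rw [← integral_indicator (measurableSet_abs_le _)]
    have h0 : (0 : ℝ) = ∫ x : ℝ, (0 : ℝ) ∂γ := by simp
    rw [h0]
    refine tendsto_integral_of_dominated_convergence (fun x => x ^ 2) (fun m => ?_) hγ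
      (fun m => Eventually.of_forall fun x => ?_) (Eventually.of_forall fun x => ?_)
    · exact hγ.1.indicator (measurableSet_abs_le _)
    · rw [Real.norm_eq_abs, Set.indicator_apply]
      split_ifs <;> simp [sq_nonneg]
    · rcases eq_or_ne x 0 with rfl | hx
      · simp [Set.indicator_apply]
      · refine tendsto_const_nhds.congr' ?_
        filter_upwards [hd0.eventually_lt_const (abs_pos.2 hx)] with m hm
        rw [Set.indicator_of_notMem]
        exact fun h : |x| ≤ d m => absurd hm h.not_gt
  simpa [approxError] using (h1.add h2).add h3

lemma integral_jumpApprox {E : Type*} [NormedAddCommGroup E] [NormedSpace ℝ E] [CompleteSpace E]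
    {f : ℝ → E} (hδ : 0 < δ) (hi : IntegrableOn f {x | δ < |x|} γ) :
    Integrable f (jumpApprox β σ γ δ) ∧
    ∫ x, f x ∂jumpApprox β σ γ δ = (∫ x in {x | δ < |x|}, f x ∂γ) +
      ((δ ^ 3)⁻¹ • f (driftApprox β γ δ * δ ^ 3) +
        (2 * δ ^ 2)⁻¹ • (f (σ * δ) + f (-(σ * δ)))) := by
  have hdi : ∀ a, Integrable f (Measure.dirac a) := fun a =>
    integrable_dirac (enorm_lt_top)
  have h1 := (hdi (driftApprox β γ δ * δ ^ 3)).smul_measure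
    (ENNReal.ofReal_ne_top (r := (δ ^ 3)⁻¹))
  have h2 := ((hdi (σ * δ)).add_measure (hdi (-(σ * δ)))).smul_measure
    (ENNReal.ofReal_ne_top (r := (2 * δ ^ 2)⁻¹))
  refine ⟨Integrable.add_measure hi (h1.add_measure h2), ?_⟩
  rw [jumpApprox, integral_add_measure hi (h1.add_measure h2), integral_add_measure h1 h2,
    integral_smul_measure, integral_smul_measure, integral_add_measure (hdi _) (hdi _),
    integral_dirac, integral_dirac, integral_dirac, ENNReal.toReal_ofReal (by positivity),
    ENNReal.toReal_ofReal (by positivity)]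

/-- Quantitative convergence of the generators of the approximating compound Poisson processes. -/
lemma norm_integral_jumpApprox_sub_le {E : Type*} [NormedAddCommGroup E] [NormedSpace ℝ E]
    [CompleteSpace E] {φ φ₁ φ₂ φ₃ : ℝ → E} {M : ℝ}
    (hγ : Integrable (fun x : ℝ => x ^ 2) γ) (hγ1 : ∀ᵐ x ∂γ, |x| ≤ 1) (hδ : 0 < δ) (hδ1 : δ ≤ 1)
    (h : ∀ x, HasDerivAt φ (φ₁ x) x) (h₁ : ∀ x, HasDerivAt φ₁ (φ₂ x) x)
    (h₂ : ∀ x, HasDerivAt φ₂ (φ₃ x) x) (hM₂ : ∀ x, |x| ≤ approxRadius β σ γ → ‖φ₂ x‖ ≤ M)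
    (hM₃ : ∀ x, |x| ≤ approxRadius β σ γ → ‖φ₃ x‖ ≤ M) :
    ‖∫ x, (φ x - φ 0) ∂jumpApprox β σ γ δ -
      (β • φ₁ 0 + (σ ^ 2 / 2) • φ₂ 0 + ∫ x, (φ x - φ 0 - x • φ₁ 0) ∂γ)‖
      ≤ approxError β σ γ δ * M := by
  have hV : 0 ≤ ∫ x, x ^ 2 ∂γ := integral_nonneg fun x => sq_nonneg x
  set R := approxRadius β σ γ with hR
  have hR1 : 1 ≤ R := by
    rw [hR, approxRadius]; have := abs_nonneg σ; have := abs_nonneg β; linarith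
  have hRσ : |σ * δ| ≤ R := by
    rw [abs_mul, abs_of_pos hδ, hR, approxRadius]
    have := mul_le_of_le_one_right (abs_nonneg σ) hδ1
    have := abs_nonneg β; linarith
  have hRb : |driftApprox β γ δ * δ ^ 3| ≤ R := by
    have h3 := abs_driftApprox_mul_le (β := β) hγ hδ hδ1
    have h4 : |driftApprox β γ δ * δ ^ 3| = |driftApprox β γ δ| * δ * δ ^ 2 := by
      rw [abs_mul, abs_of_pos (by positivity : 0 < δ ^ 3)]; ring
    have h5 : |driftApprox β γ δ| * δ * δ ^ 2 ≤ |driftApprox β γ δ| * δ :=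
      mul_le_of_le_one_right (by positivity) (pow_le_one₀ hδ.le hδ1)
    rw [h4, hR, approxRadius]
    have := abs_nonneg σ; linarith
  have hT1 : ∀ x, |x| ≤ R → ‖φ x - φ 0 - x • φ₁ 0‖ ≤ M * x ^ 2 := fun x hx =>
    norm_taylor_one_le (fun x _ => h x) (fun x _ => h₁ x) hM₂ hx
  have hT2 : ∀ x, |x| ≤ R → ‖φ x - φ 0 - x • φ₁ 0 - (x ^ 2 / 2) • φ₂ 0‖ ≤ M * |x| ^ 3 :=
    fun x hx => norm_taylor_two_le (fun x _ => h x) (fun x _ => h₁ x) (fun x _ => h₂ x) hM₃ hx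
  have hcont : Continuous φ := continuous_iff_continuousAt.2 fun x => (h x).continuousAt
  have hint : Integrable (fun x => φ x - φ 0 - x • φ₁ 0) γ := by
    refine (hγ.const_mul M).mono' (by fun_prop) ?_
    filter_upwards [hγ1] with x hx using hT1 x (hx.trans hR1)
  have hid := (integrableOn_id_of_sq hγ hδ).smul_const (φ₁ 0)
  have hφi : IntegrableOn (fun x => φ x - φ 0) {x | δ < |x|} γ := by
    refine (hint.integrableOn.add hid).congr (Eventually.of_forall fun x => ?_)
    simp
  obtain ⟨-, hI⟩ := integral_jumpApprox (β := β) (σ := σ) (f := fun x => φ x - φ 0) hδ hφi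
  have hcompl : {x : ℝ | |x| ≤ δ}ᶜ = {x | δ < |x|} := by ext x; simp
  have hsplit := integral_add_compl (measurableSet_abs_le δ) hint
  rw [hcompl] at hsplit
  have hlarge : ∫ x in {x | δ < |x|}, (φ x - φ 0 - x • φ₁ 0) ∂γ
      = (∫ x in {x | δ < |x|}, (φ x - φ 0) ∂γ) - (∫ x in {x | δ < |x|}, x ∂γ) • φ₁ 0 := by
    rw [integral_sub hφi hid, integral_smul_const]
  have hsmall : ‖∫ x in {x | |x| ≤ δ}, (φ x - φ 0 - x • φ₁ 0) ∂γ‖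
      ≤ (∫ x in {x | |x| ≤ δ}, x ^ 2 ∂γ) * M := by
    rw [mul_comm, ← integral_const_mul]
    refine norm_integral_le_of_norm_le (hγ.integrableOn.const_mul M) ?_
    filter_upwards [ae_restrict_of_ae hγ1] with x hx using hT1 x (hx.trans hR1)
  set b := driftApprox β γ δ with hb
  have hbβ : β = b + ∫ x in {x | δ < |x|}, x ∂γ := by rw [hb, driftApprox]; ring
  -- The atoms are tuned so that only Taylor remainders survive: the drift atom reproduces the
  -- first-order term exactly, and the symmetric pair ±σδ cancels at first order and gives (σ²/2)
  -- φ₂(0) at second. The compensator of jumps above δ is absorbed by the modified drift.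
  have e1 : ∫ x, (φ x - φ 0) ∂jumpApprox β σ γ δ -
      (β • φ₁ 0 + (σ ^ 2 / 2) • φ₂ 0 + ∫ x, (φ x - φ 0 - x • φ₁ 0) ∂γ)
      = (δ ^ 3)⁻¹ • (φ (b * δ ^ 3) - φ 0 - (b * δ ^ 3) • φ₁ 0)
        + (2 * δ ^ 2)⁻¹ • ((φ (σ * δ) - φ 0 - (σ * δ) • φ₁ 0 - ((σ * δ) ^ 2 / 2) • φ₂ 0)
          + (φ (-(σ * δ)) - φ 0 - (-(σ * δ)) • φ₁ 0 - ((-(σ * δ)) ^ 2 / 2) • φ₂ 0))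
        - ∫ x in {x | |x| ≤ δ}, (φ x - φ 0 - x • φ₁ 0) ∂γ := by
    rw [hI, ← hsplit, hlarge]
    nth_rewrite 1 [hbβ]
    have c1 : (δ ^ 3)⁻¹ • (b * δ ^ 3) • φ₁ 0 = b • φ₁ 0 := by
      rw [smul_smul]; congr 1; field_simp
    have c2 : (2 * δ ^ 2)⁻¹ • ((σ * δ) ^ 2 / 2) • φ₂ 0 = (σ ^ 2 / 4) • φ₂ 0 := by
      rw [smul_smul]; congr 1; field_simp; ring
    simp only [smul_sub, smul_add, add_smul, neg_sq, neg_smul, c1, c2]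
    have c3 : (σ ^ 2 / 2) • φ₂ 0 = (σ ^ 2 / 4) • φ₂ 0 + (σ ^ 2 / 4) • φ₂ 0 := by
      rw [← add_smul]; congr 1; ring
    rw [c3, smul_neg]
    abel
  rw [e1]
  refine (norm_sub_le _ _).trans ?_
  rw [approxError, add_mul, add_mul]
  refine add_le_add ((norm_add_le _ _).trans (add_le_add ?_ ?_)) hsmall
  · rw [norm_smul, Real.norm_of_nonneg (by positivity)]
    refine (mul_le_mul_of_nonneg_left (hT1 _ hRb) (by positivity)).trans_eq ?_
    rw [← hb]; field_simp
  · rw [norm_smul, Real.norm_of_nonneg (by positivity)]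
    have h5 := (norm_add_le _ _).trans (add_le_add (hT2 _ hRσ) (hT2 _ ((abs_neg (σ * δ)).symm ▸ hRσ)))
    refine (mul_le_mul_of_nonneg_left h5 (by positivity)).trans_eq ?_
    rw [abs_neg, abs_mul, abs_of_pos hδ]
    field_simp; ring

end

/-! ### Expansion in time of the approximating semigroups. -/

lemma integral_compoundPoisson_zero {η : Measure ℝ} [IsFiniteMeasure η] {f : ℝ → ℝ}
    (hf : Continuous f) {M : ℝ} (hM : ∀ x, |f x| ≤ M) :
    ∫ x, f x ∂compoundPoisson η 0 = f 0 := by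
  have h := hasSum_integral_compoundPoisson (η := η) le_rfl
    (integrable_compoundPoisson le_rfl hf.stronglyMeasurable hM)
  refine h.unique ?_
  have h0 := hasSum_single (α := ℝ) (f := fun k : ℕ => (Real.exp (-(0 * η.real Set.univ)) *
    (0 ^ k / k.factorial)) • ∫ x, f x ∂convPowMeasure η k) 0 (fun k hk => by simp [hk])
  simpa [convPowMeasure] using h0

lemma hasDerivAt_sum_pow_div_factorial (a : ℕ → ℝ) (N : ℕ) (t : ℝ) :
    HasDerivAt (fun t : ℝ => ∑ q ∈ Finset.range (N + 1), t ^ q / q.factorial * a q)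
      (∑ q ∈ Finset.range N, t ^ q / q.factorial * a (q + 1)) t := by
  have h : ∀ q ∈ Finset.range (N + 1), HasDerivAt (fun t : ℝ => t ^ q / q.factorial * a q)
      (q * t ^ (q - 1) / q.factorial * a q) t := fun q _ => by
    simpa using ((hasDerivAt_pow q t).div_const (q.factorial : ℝ)).mul_const (a q)
  have h1 := HasDerivAt.fun_sum h
  rw [Finset.sum_range_succ'] at h1
  simp only [Nat.cast_zero, zero_mul, zero_div, add_zero] at h1
  refine h1.congr_deriv (Finset.sum_congr rfl fun q _ => ?_)
  rw [Nat.factorial_succ]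
  have : (q.factorial : ℝ) ≠ 0 := by positivity
  have : ((q : ℝ) + 1) ≠ 0 := by positivity
  push_cast; field_simp

section

variable {β σ : ℝ} {γ : Measure ℝ}

lemma abs_integral_jumpApprox_sub_levyGenerator_le {F : ℝ → ℝ} (hF : IsBddSmooth F)
    (hγ : Integrable (fun x : ℝ => x ^ 2) γ) (hγ1 : ∀ᵐ x ∂γ, |x| ≤ 1) :
    ∃ C, 0 ≤ C ∧ ∀ δ, 0 < δ → δ ≤ 1 → ∀ y,
      |∫ x, (F (y + x) - F y) ∂jumpApprox β σ γ δ - levyGenerator β σ γ F y|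
        ≤ C * approxError β σ γ δ := by
  obtain ⟨M₂, h₂, hM₂⟩ := hF.bounded_iteratedDeriv 2
  obtain ⟨M₃, h₃, hM₃⟩ := hF.bounded_iteratedDeriv 3
  refine ⟨M₂ + M₃, by positivity, fun δ hδ hδ1 y => ?_⟩
  have hd := fun k x => (hF.hasDerivAt_iteratedDeriv k (y + x)).comp_const_add y x
  have := norm_integral_jumpApprox_sub_le (β := β) (σ := σ)
    (φ := fun x => iteratedDeriv 0 F (y + x)) (M := M₂ + M₃)
    hγ hγ1 hδ hδ1 (hd 0) (hd 1) (hd 2) (fun x _ => (hM₂ _).trans (by linarith))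
    (fun x _ => (hM₃ _).trans (by linarith))
  rw [mul_comm]
  simpa [levyGenerator] using this

/-- Taylor expansion in time of the transition semigroup of the approximating processes, in terms
of the powers of the limiting generator. -/
lemma abs_integral_compoundPoisson_sub_taylor_le (hγ : Integrable (fun x : ℝ => x ^ 2) γ)
    (hγ1 : ∀ᵐ x ∂γ, |x| ≤ 1) (N : ℕ) {F : ℝ → ℝ} (hF : IsBddSmooth F) {M : ℝ}
    (hM : ∀ y, |(levyGenerator β σ γ)^[N] F y| ≤ M) :
    ∃ K, 0 ≤ K ∧ ∀ δ, 0 < δ → δ ≤ 1 → ∀ t, 0 ≤ t → t ≤ 1 → ∀ y,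
      |∫ x, F (y + x) ∂compoundPoisson (jumpApprox β σ γ δ) t -
        ∑ q ∈ Finset.range N, t ^ q / q.factorial * (levyGenerator β σ γ)^[q] F y|
        ≤ M * (t ^ N / N.factorial) + K * approxError β σ γ δ := by
  induction N generalizing F with
  | zero =>
    refine ⟨0, le_rfl, fun δ hδ _ t ht _ y => ?_⟩
    have := isFiniteMeasure_jumpApprox (β := β) (σ := σ) hγ hδ
    have := isProbabilityMeasure_compoundPoisson (η := jumpApprox β σ γ δ) ht
    have h := norm_integral_le_of_norm_le_const (μ := compoundPoisson (jumpApprox β σ γ δ) t)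
      (f := fun x => F (y + x)) (C := M) (Eventually.of_forall fun x => by simpa using hM (y + x))
    simpa using h
  | succ N ih =>
    -- The time derivative of the order N+1 remainder for F is the order N remainder for the
    -- generator applied to F, up to the error C e of replacing the approximate generator by the
    -- limiting one.
    obtain ⟨K, hK0, hK⟩ := ih (hF.levyGenerator β σ hγ) (fun y => by
      simpa only [Function.iterate_succ_apply] using hM y)
    obtain ⟨C, hC0, hC⟩ :=
      abs_integral_jumpApprox_sub_levyGenerator_le (β := β) (σ := σ) hF hγ hγ1
    obtain ⟨B, -, hB⟩ := hF.bounded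
    obtain ⟨B', -, hB'⟩ := (hF.levyGenerator β σ hγ).bounded
    refine ⟨K + C, by positivity, fun δ hδ hδ1 t ht ht1 y => ?_⟩
    have hη := isFiniteMeasure_jumpApprox (β := β) (σ := σ) hγ hδ
    set η := jumpApprox β σ γ δ with hηdef
    set e := approxError β σ γ δ with he
    have he0 : 0 ≤ e := approxError_nonneg hδ
    have hc : Continuous fun x => F (y + x) := by have := hF.continuous; fun_prop
    have hder := fun s (hs : 0 ≤ s) => (hasDerivWithinAt_integral_compoundPoisson (η := η) hc
      (fun x => hB (y + x)) hs).sub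
      (hasDerivAt_sum_pow_div_factorial (fun q => (levyGenerator β σ γ)^[q] F y)
        N s).hasDerivWithinAt
    have hbd : ∀ s, 0 ≤ s → s ≤ 1 →
        |(∫ x, ∫ u, (F (y + (x + u)) - F (y + x)) ∂η ∂compoundPoisson η s) -
          ∑ q ∈ Finset.range N, s ^ q / q.factorial * (levyGenerator β σ γ)^[q + 1] F y|
          ≤ M * (s ^ N / N.factorial) + (K + C) * e := fun s hs hs1 => by
      have hprob := isProbabilityMeasure_compoundPoisson (η := η) hs
      have hLi : Integrable (fun x => levyGenerator β σ γ F (y + x)) (compoundPoisson η s) :=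
        integrable_compoundPoisson hs (by
          have := (hF.levyGenerator β σ hγ).continuous
          exact Continuous.stronglyMeasurable (by fun_prop)) (fun x => hB' _)
      have hFi : Integrable (fun x => ∫ u, (F (y + (x + u)) - F (y + x)) ∂η)
          (compoundPoisson η s) := by
        refine integrable_compoundPoisson hs ((Continuous.stronglyMeasurable
          (f := fun p : ℝ × ℝ => F (y + (p.1 + p.2)) - F (y + p.1)) (by
            have := hF.continuous; fun_prop)).integral_prod_right)
          (M := (B + B) * η.real Set.univ) (fun x => ?_)
        exact norm_integral_le_of_norm_le_const (Eventually.of_forall fun u =>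
          (norm_sub_le _ _).trans (add_le_add (hB _) (hB _)))
      have h1 : |(∫ x, ∫ u, (F (y + (x + u)) - F (y + x)) ∂η ∂compoundPoisson η s) -
          ∫ x, levyGenerator β σ γ F (y + x) ∂compoundPoisson η s| ≤ C * e := by
        rw [← integral_sub hFi hLi]
        have := norm_integral_le_of_norm_le_const (μ := compoundPoisson η s) (C := C * e)
          (f := fun x => (∫ u, (F (y + (x + u)) - F (y + x)) ∂η) - levyGenerator β σ γ F (y + x))
          (Eventually.of_forall fun x => by
            simpa only [add_assoc, Real.norm_eq_abs] using hC δ hδ hδ1 (y + x))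
        simpa using this
      have h2 := hK δ hδ hδ1 s hs hs1 y
      simp only [← Function.iterate_succ_apply, Nat.succ_eq_add_one] at h2
      have h3 := abs_sub_le (∫ x, ∫ u, (F (y + (x + u)) - F (y + x)) ∂η ∂compoundPoisson η s)
        (∫ x, levyGenerator β σ γ F (y + x) ∂compoundPoisson η s)
        (∑ q ∈ Finset.range N, s ^ q / q.factorial * (levyGenerator β σ γ)^[q + 1] F y)
      linarith
    have hBder : ∀ s : ℝ, HasDerivAt (fun s : ℝ => M * (s ^ (N + 1) / (N + 1).factorial)
        + (K + C) * e * s) (M * (s ^ N / N.factorial) + (K + C) * e) s := fun s => by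
      have h1 := (((hasDerivAt_pow (N + 1) s).div_const ((N + 1).factorial : ℝ)).const_mul M).add
        ((hasDerivAt_id s).const_mul ((K + C) * e))
      refine h1.congr_deriv ?_
      rw [Nat.factorial_succ]
      have : (N.factorial : ℝ) ≠ 0 := by positivity
      have : ((N : ℝ) + 1) ≠ 0 := by positivity
      push_cast; field_simp
    -- Integrating the derivative bound from s = 0, where the remainder vanishes, by comparison with
    -- an explicit primitive.
    have main := image_norm_le_of_norm_deriv_right_le_deriv_boundary (a := 0) (b := 1)
      (f := fun s => ∫ x, F (y + x) ∂compoundPoisson η s -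
        ∑ q ∈ Finset.range (N + 1), s ^ q / q.factorial * (levyGenerator β σ γ)^[q] F y)
      (fun s hs => ((hder s hs.1).continuousWithinAt).mono Set.Icc_subset_Ici_self)
      (fun s hs => (hder s hs.1).mono (Set.Ici_subset_Ici.2 hs.1))
      (by
        rw [integral_compoundPoisson_zero hc (fun x => hB (y + x)), Finset.sum_range_succ']
        simp) hBder (fun s hs => hbd s hs.1 hs.2.le) ⟨ht, ht1⟩
    refine main.trans ?_
    have : (K + C) * e * t ≤ (K + C) * e := mul_le_of_le_one_right (by positivity) ht1
    linarith

end

/-! ### Measures with densities and their convolution powers. -/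

/-- The measure with density `f` with respect to `μ`. -/
def densityMeasure (μ : Measure ℝ) (f : ℝ → ℝ) : Measure ℝ :=
  μ.withDensity fun x => ENNReal.ofReal (f x)

section densityMeasure

variable {μ : Measure ℝ} {f : ℝ → ℝ}

lemma integral_densityMeasure {E : Type*} [NormedAddCommGroup E] [NormedSpace ℝ E]
    (hf : Measurable f) (h0 : ∀ x, 0 ≤ f x) (g : ℝ → E) :
    ∫ x, g x ∂densityMeasure μ f = ∫ x, f x • g x ∂μ := by
  rw [densityMeasure, integral_withDensity_eq_integral_toReal_smul (by fun_prop) (by simp)]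
  simp_rw [ENNReal.toReal_ofReal (h0 _)]

lemma integrable_densityMeasure_iff {E : Type*} [NormedAddCommGroup E] [NormedSpace ℝ E]
    (hf : Measurable f) (h0 : ∀ x, 0 ≤ f x) {g : ℝ → E} :
    Integrable g (densityMeasure μ f) ↔ Integrable (fun x => f x • g x) μ := by
  rw [densityMeasure, integrable_withDensity_iff_integrable_smul' (by fun_prop) (by simp)]
  simp_rw [ENNReal.toReal_ofReal (h0 _)]

lemma isFiniteMeasure_densityMeasure (hi : Integrable f μ) :
    IsFiniteMeasure (densityMeasure μ f) := isFiniteMeasure_withDensity_ofReal hi.2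

lemma integrable_of_isFiniteMeasure_densityMeasure (hf : Measurable f) (h0 : ∀ x, 0 ≤ f x)
    [IsFiniteMeasure (densityMeasure μ f)] : Integrable f μ := by
  have h := (integrable_densityMeasure_iff hf h0).1
    (integrable_const (1 : ℝ) (μ := densityMeasure μ f))
  simpa using h

end densityMeasure

section convPow

variable {f : ℝ → ℝ}

/-- The four properties are proved together because each induction step uses the others. The index
starts at one since the zeroth convolution power is a Dirac mass without density. -/
lemma convPow_succ_spec (hf : IsBddSmooth f) (hi : Integrable f) (h0 : ∀ x, 0 ≤ f x) (k : ℕ) :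
    IsBddSmooth (convPow f (k + 1)) ∧ Integrable (convPow f (k + 1)) ∧
      (∀ x, 0 ≤ convPow f (k + 1) x) ∧
      convPowMeasure (densityMeasure volume f) (k + 1)
        = densityMeasure volume (convPow f (k + 1)) := by
  have hfin := isFiniteMeasure_densityMeasure hi
  induction k with
  | zero => exact ⟨hf, hi, h0, by simp [convPowMeasure, convPow]⟩
  | succ k ih =>
    obtain ⟨h1, h2, h3, h4⟩ := ih
    obtain ⟨M, -, hM⟩ := h1.bounded
    have hsm : IsBddSmooth (convPow f (k + 2)) := h1.integral_comp_sub hi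
    have hnn : ∀ x, 0 ≤ convPow f (k + 2) x := fun x =>
      integral_nonneg fun u => mul_nonneg (h3 _) (h0 u)
    have hmeas : convPowMeasure (densityMeasure volume f) (k + 2)
        = densityMeasure volume (convPow f (k + 2)) := by
      have hm : ∀ {g : ℝ → ℝ}, IsBddSmooth g → Measurable fun x => ENNReal.ofReal (g x) :=
        fun hg => hg.continuous.measurable.ennreal_ofReal
      have : IsFiniteMeasure (densityMeasure volume (convPow f (k + 1))) := by
        rw [← h4]; infer_instance
      rw [convPowMeasure, h4, Measure.conv_comm, densityMeasure, densityMeasure,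
        conv_withDensity_eq_lconvolution (hm hf) (hm h1), densityMeasure]
      congr 1
      funext x
      rw [lconvolution_def, convPow, ofReal_integral_eq_lintegral_ofReal]
      · refine lintegral_congr fun u => ?_
        rw [← ENNReal.ofReal_mul (h0 u), mul_comm, neg_add_eq_sub]
      · refine hi.bdd_mul (c := M) ?_ (Eventually.of_forall fun u => hM _)
        have := h1.continuous
        exact Continuous.aestronglyMeasurable (by fun_prop)
      · exact Eventually.of_forall fun u => mul_nonneg (h3 _) (h0 u)
    refine ⟨hsm, ?_, hnn, hmeas⟩
    -- Integrability of the density is read off from finiteness of the convolved measure.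
    have : IsFiniteMeasure (densityMeasure volume (convPow f (k + 2))) := by
      rw [← hmeas]; infer_instance
    exact integrable_of_isFiniteMeasure_densityMeasure hsm.continuous.measurable hnn

end convPow

/-! ### The put payoff and its smoothing. -/

/-- The put payoff `(e^w - 1)_-`. -/
def putPayoff (w : ℝ) : ℝ := max (-(Real.exp w - 1)) 0

lemma continuous_putPayoff : Continuous putPayoff := by unfold putPayoff; fun_prop

lemma putPayoff_nonneg (w : ℝ) : 0 ≤ putPayoff w := le_max_right _ _

lemma abs_putPayoff_le (w : ℝ) : |putPayoff w| ≤ 1 := by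
  rw [abs_of_nonneg (putPayoff_nonneg w)]
  exact max_le (by have := Real.exp_pos w; linarith) zero_le_one

lemma putPayoff_of_nonneg {w : ℝ} (hw : 0 ≤ w) : putPayoff w = 0 :=
  max_eq_right (by have := Real.one_le_exp hw; linarith)

lemma putPayoff_of_nonpos {w : ℝ} (hw : w ≤ 0) : putPayoff w = 1 - Real.exp w := by
  rw [putPayoff, max_eq_left]
  · ring
  · have := Real.exp_le_one_iff.2 hw; linarith

/-- In this form the payoff is visibly 1-Lipschitz, exp being so on the nonpositive axis. -/
lemma putPayoff_eq (w : ℝ) : putPayoff w = 1 - Real.exp (min w 0) := by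
  rcases le_total w 0 with h | h
  · rw [putPayoff_of_nonpos h, min_eq_left h]
  · rw [putPayoff_of_nonneg h, min_eq_right h]; simp

lemma abs_exp_sub_exp_le {a b : ℝ} (ha : a ≤ 0) (hb : b ≤ 0) :
    |Real.exp a - Real.exp b| ≤ |a - b| := by
  have := Convex.norm_image_sub_le_of_norm_hasDerivWithin_le (s := Set.Iic (0 : ℝ))
    (f := Real.exp) (f' := Real.exp) (C := 1) (x := b) (y := a)
    (fun x _ => (Real.hasDerivAt_exp x).hasDerivWithinAt)
    (fun x hx => by
      rw [Real.norm_eq_abs, abs_of_pos (Real.exp_pos x)]; exact Real.exp_le_one_iff.2 hx)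
    (convex_Iic 0) hb ha
  simpa using this

lemma abs_putPayoff_sub_le (v w : ℝ) : |putPayoff v - putPayoff w| ≤ |v - w| := by
  rw [putPayoff_eq, putPayoff_eq]
  calc |1 - Real.exp (min v 0) - (1 - Real.exp (min w 0))|
      = |Real.exp (min w 0) - Real.exp (min v 0)| := by congr 1; ring
    _ ≤ |min w 0 - min v 0| := abs_exp_sub_exp_le (min_le_right _ _) (min_le_right _ _)
    _ ≤ |w - v| := by simpa using abs_min_sub_min_le_max w 0 v 0
    _ = |v - w| := abs_sub_comm _ _

/-- The Chernoff bound used when there is no large jump. -/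
lemma putPayoff_le_exp {r : ℝ} (hr : 0 ≤ r) (w : ℝ) : putPayoff w ≤ Real.exp (-r * w) := by
  rcases le_total w 0 with h | h
  · exact ((le_abs_self _).trans (abs_putPayoff_le w)).trans
      (Real.one_le_exp (by nlinarith))
  · rw [putPayoff_of_nonneg h]; exact (Real.exp_pos _).le

/-- The a.e. derivative of the put payoff. -/
def putDeriv (w : ℝ) : ℝ := (Set.Iio 0).indicator (fun w => -Real.exp w) w

lemma hasDerivAt_putPayoff {w : ℝ} (hw : w ≠ 0) : HasDerivAt putPayoff (putDeriv w) w := by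
  rcases hw.lt_or_gt with h | h
  · rw [putDeriv, Set.indicator_of_mem (Set.mem_Iio.2 h)]
    refine ((Real.hasDerivAt_exp w).const_sub 1).congr_of_eventuallyEq ?_
    filter_upwards [Iio_mem_nhds h] with v hv using putPayoff_of_nonpos (le_of_lt hv)
  · rw [putDeriv, Set.indicator_of_notMem (by simpa using h.le)]
    refine (hasDerivAt_const w (0 : ℝ)).congr_of_eventuallyEq ?_
    filter_upwards [Ioi_mem_nhds h] with v hv using putPayoff_of_nonneg (le_of_lt hv)

lemma measurable_putDeriv : Measurable putDeriv :=
  Measurable.indicator (by fun_prop) measurableSet_Iio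

lemma integrable_putDeriv : Integrable putDeriv := by
  have : IntegrableOn (fun w => -Real.exp w) (Set.Iio 0) :=
    ((integrableOn_exp_Iic 0).mono_set Set.Iio_subset_Iic_self).neg
  exact this.integrable_indicator measurableSet_Iio

lemma integrable_putPayoff_mul {r : ℝ → ℝ} (hi : Integrable r) (x : ℝ) :
    Integrable fun u => putPayoff (x + u) * r u :=
  hi.bdd_mul (c := 1) (continuous_putPayoff.comp (by fun_prop)).aestronglyMeasurable
    (Eventually.of_forall fun u => abs_putPayoff_le _)

/-- Averaging the put payoff against a bounded smooth density smooths it. -/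
lemma isBddSmooth_integral_putPayoff {r : ℝ → ℝ} (hr : IsBddSmooth r) (hi : Integrable r) :
    IsBddSmooth fun x => ∫ u, putPayoff (x + u) * r u := by
  -- The payoff is differentiated only once. The substitution w = x + u then moves x into r, and all
  -- later derivatives fall on r against an integrable weight.
  have hder : IsBddSmooth fun x => ∫ w, putDeriv w * r (w - x) := by
    have := isBddSmooth_integral (μ := volume) (w := fun w => |putDeriv w|)
      (K := fun k x w => putDeriv w * ((-1) ^ k * iteratedDeriv k r (w - x)))
      integrable_putDeriv.abs
      (fun k y => by
        have := (hr.iteratedDeriv k).continuous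
        exact measurable_putDeriv.aestronglyMeasurable.mul
          (Continuous.aestronglyMeasurable (by fun_prop)))
      (fun k y w => by
        refine ((((hr.hasDerivAt_iteratedDeriv k (w - y)).comp_const_sub w y).const_mul
          ((-1) ^ k)).const_mul (putDeriv w)).congr_deriv ?_
        rw [pow_succ]; ring)
      (fun k => by
        obtain ⟨M, -, hM⟩ := hr.bounded_iteratedDeriv k
        refine ⟨M, fun y w => ?_⟩
        rw [abs_mul, abs_mul, abs_pow, abs_neg, abs_one, one_pow, one_mul, mul_comm]
        gcongr
        exact hM _)
    simpa using this
  refine hder.of_hasDerivAt (fun x => ?_) ⟨∫ u, |r u|, fun x => ?_⟩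
  · have hchange : ∫ w, putDeriv w * r (w - x) = ∫ u, putDeriv (x + u) * r u := by
      rw [← integral_add_left_eq_self (fun w => putDeriv w * r (w - x)) x]
      simp
    rw [hchange]
    refine (hasDerivAt_integral_of_dominated_loc_of_lip (s := Set.univ)
      (F := fun x u => putPayoff (x + u) * r u) (bound := fun u => |r u|) univ_mem
      (Eventually.of_forall fun y => (integrable_putPayoff_mul hi y).1)
      (integrable_putPayoff_mul hi x)
      ((measurable_putDeriv.comp (measurable_const_add x)).aestronglyMeasurable.mul hi.1)
      (Eventually.of_forall fun u => ?_) hi.abs ?_).2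
    · refine LipschitzOnWith.of_dist_le_mul fun y _ y' _ => ?_
      rw [Real.dist_eq, Real.dist_eq, Real.coe_nnabs, abs_abs, ← sub_mul, abs_mul, mul_comm]
      refine mul_le_mul_of_nonneg_left ?_ (abs_nonneg _)
      simpa using abs_putPayoff_sub_le (y + u) (y' + u)
    -- The kink of the payoff is met only at u = -x, a null set.
    · have : ∀ᵐ u : ℝ, u ≠ -x := by
        rw [ae_iff]; simp
      filter_upwards [this] with u hu
      have hne : x + u ≠ 0 := fun h => hu (by linarith)
      exact ((hasDerivAt_putPayoff hne).comp_add_const x u).mul_const _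
  · refine norm_integral_le_of_norm_le (f := fun u => putPayoff (x + u) * r u) hi.abs (Eventually.of_forall fun u => ?_)
    rw [Real.norm_eq_abs, abs_mul]
    exact mul_le_of_le_one_left (abs_nonneg _) (abs_putPayoff_le _)

/-! ### Splitting the Lévy measure into small and large jumps. -/

section triplet

variable {b σ ε : ℝ} {c s : ℝ → ℝ} {ν : Measure ℝ}

namespace IsTruncation

lemma nonneg (hc : IsTruncation ε c) (x : ℝ) : 0 ≤ c x :=
  (Set.indicator_nonneg (fun _ _ => zero_le_one) x).trans (hc.lower x)

lemma le_one (hc : IsTruncation ε c) (x : ℝ) : c x ≤ 1 :=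
  (hc.upper x).trans (Set.indicator_le_self' (fun _ _ => zero_le_one) x)

lemma measurable (hc : IsTruncation ε c) : Measurable c := hc.smooth.continuous.measurable

lemma eq_zero (hc : IsTruncation ε c) {x : ℝ} (hx : ε < |x|) : c x = 0 := by
  refine le_antisymm ((hc.upper x).trans_eq (Set.indicator_of_notMem ?_ _)) (hc.nonneg x)
  exact fun h => hx.not_ge (abs_le.2 h)

lemma eq_one (hc : IsTruncation ε c) {x : ℝ} (hx : |x| ≤ ε / 2) : c x = 1 := by
  refine le_antisymm (hc.le_one x) ?_
  have := hc.lower x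
  rwa [Set.indicator_of_mem (show x ∈ Set.Icc _ _ from abs_le.1 hx)] at this

end IsTruncation

lemma HasSmoothDensity.measurable (hs : HasSmoothDensity ν s) : Measurable s :=
  measurable_of_continuousOn_compl_singleton 0 hs.smooth.continuousOn

lemma largeDensity_nonneg (hs : HasSmoothDensity ν s) (hc : IsTruncation ε c) (hε : 0 < ε)
    (x : ℝ) : 0 ≤ largeDensity c s x := by
  rcases eq_or_ne x 0 with rfl | hx
  · rw [largeDensity, hc.eq_one (by simp; positivity)]; simp
  · exact mul_nonneg (sub_nonneg.2 (hc.le_one x)) (hs.nonneg x hx)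

/-- Near 0 the density vanishes because c = 1 there; on [-1, 1] derivatives are bounded by
compactness; beyond, c = 0 as ε < 1, and the density coincides with s. -/
lemma isBddSmooth_largeDensity (hs : HasSmoothDensity ν s) (hc : IsTruncation ε c) (hε : 0 < ε)
    (hε1 : ε < 1) : IsBddSmooth (largeDensity c s) := by
  have hcd : ContDiff ℝ ∞ (largeDensity c s) := by
    rw [contDiff_iff_contDiffAt]
    intro x
    rcases eq_or_ne x 0 with rfl | hx
    · refine (contDiffAt_const (c := (0 : ℝ))).congr_of_eventuallyEq ?_
      filter_upwards [Metric.ball_mem_nhds (0 : ℝ) (half_pos hε)] with y hy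
      rw [Metric.mem_ball, Real.dist_eq, sub_zero] at hy
      rw [largeDensity, hc.eq_one hy.le]; simp
    · exact (contDiffAt_const.sub hc.smooth.contDiffAt).mul
        (hs.smooth.contDiffAt (isOpen_compl_singleton.mem_nhds hx))
  refine IsBddSmooth.of_contDiff hcd fun k => ?_
  have hcont : Continuous (iteratedDeriv k (largeDensity c s)) :=
    hcd.continuous_iteratedDeriv k (by exact_mod_cast le_top)
  obtain ⟨M, hM⟩ := (isCompact_Icc (a := (-1 : ℝ)) (b := 1)).exists_bound_of_continuousOn
    hcont.continuousOn
  obtain ⟨M', hM'⟩ := hs.bounded k 1 one_pos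
  refine ⟨max M M', fun x => ?_⟩
  rcases le_or_gt |x| 1 with hx | hx
  · exact (hM x (abs_le.1 hx)).trans (le_max_left _ _)
  · have : largeDensity c s =ᶠ[𝓝 x] s := by
      filter_upwards [(isOpen_lt continuous_const continuous_abs).mem_nhds hx] with y hy
      have hy : 1 < |y| := hy
      rw [largeDensity, hc.eq_zero (hε1.trans hy)]; simp
    rw [this.iteratedDeriv_eq]
    exact (hM' x hx).trans (le_max_right _ _)

/-- The measure of the small jumps. -/
def smallJumps (c : ℝ → ℝ) (ν : Measure ℝ) : Measure ℝ := densityMeasure ν c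

/-- The measure of the large jumps. -/
def largeJumps (c : ℝ → ℝ) (ν : Measure ℝ) : Measure ℝ := densityMeasure ν fun x => 1 - c x

lemma ae_abs_le_smallJumps (hc : IsTruncation ε c) :
    ∀ᵐ x ∂smallJumps c ν, |x| ≤ ε := by
  rw [smallJumps, densityMeasure, ae_withDensity_iff (by have := hc.measurable; fun_prop)]
  refine Eventually.of_forall fun x hx => ?_
  by_contra! h
  exact hx (by simp [hc.eq_zero h])

lemma integrable_sq_smallJumps (hν : IsLevyMeasure ν) (hc : IsTruncation ε c) (hε1 : ε < 1) :
    Integrable (fun x : ℝ => x ^ 2) (smallJumps c ν) := by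
  rw [smallJumps, integrable_densityMeasure_iff hc.measurable hc.nonneg]
  have := hc.measurable
  refine hν.integrable_min.mono' (by simp only [smul_eq_mul]; fun_prop)
    (Eventually.of_forall fun x => ?_)
  rw [smul_eq_mul, Real.norm_eq_abs, abs_of_nonneg (mul_nonneg (hc.nonneg x) (sq_nonneg x))]
  rcases le_or_gt |x| ε with hx | hx
  · have h1 : x ^ 2 ≤ 1 := by
      rw [← sq_abs]; exact pow_le_one₀ (abs_nonneg x) (hx.trans hε1.le)
    rw [min_eq_right h1]
    exact mul_le_of_le_one_left (sq_nonneg x) (hc.le_one x)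
  · rw [hc.eq_zero hx, zero_mul]; positivity

/-- Since 1 - c vanishes on |x| ≤ ε/2, it is dominated by (ε/2)⁻² min(1, x²). -/
lemma integrable_one_sub (hν : IsLevyMeasure ν) (hc : IsTruncation ε c) (hε : 0 < ε)
    (hε1 : ε < 1) : Integrable (fun x => 1 - c x) ν := by
  have := hc.measurable
  refine (hν.integrable_min.const_mul ((ε / 2) ^ 2)⁻¹).mono' (by fun_prop)
    (Eventually.of_forall fun x => ?_)
  rw [Real.norm_eq_abs, abs_of_nonneg (sub_nonneg.2 (hc.le_one x))]
  rcases le_or_gt |x| (ε / 2) with hx | hx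
  · rw [hc.eq_one hx, sub_self]; positivity
  · rw [inv_mul_eq_div, le_div_iff₀ (by positivity)]
    have h1 : (ε / 2) ^ 2 ≤ min 1 (x ^ 2) := by
      refine le_min (pow_le_one₀ (by positivity) (by linarith)) ?_
      rw [← sq_abs x]; gcongr
    have h2 : (1 - c x) * (ε / 2) ^ 2 ≤ (ε / 2) ^ 2 :=
      mul_le_of_le_one_left (by positivity) (by have := hc.nonneg x; linarith)
    exact h2.trans h1

lemma largeJumps_eq (hs : HasSmoothDensity ν s) (hc : IsTruncation ε c) :
    largeJumps c ν = densityMeasure volume (largeDensity c s) := by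
  have := hc.measurable
  have := hs.measurable
  rw [largeJumps, densityMeasure, hs.density, ← withDensity_mul _ (by fun_prop) (by fun_prop),
    densityMeasure]
  congr 1
  funext x
  rw [Pi.mul_apply, largeDensity, ENNReal.ofReal_mul (sub_nonneg.2 (hc.le_one x)), mul_comm]

lemma smallJumps_add_largeJumps (hc : IsTruncation ε c) :
    smallJumps c ν + largeJumps c ν = ν := by
  have := hc.measurable
  rw [smallJumps, largeJumps, densityMeasure, densityMeasure, ← withDensity_add_left (by fun_prop)]
  have : ((fun x => ENNReal.ofReal (c x)) + fun x => ENNReal.ofReal (1 - c x)) = 1 := by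
    funext x
    rw [Pi.add_apply, ← ENNReal.ofReal_add (hc.nonneg x) (sub_nonneg.2 (hc.le_one x))]
    simp
  rw [this, withDensity_one]

lemma isFiniteMeasure_largeJumps (hν : IsLevyMeasure ν) (hc : IsTruncation ε c) (hε : 0 < ε)
    (hε1 : ε < 1) : IsFiniteMeasure (largeJumps c ν) :=
  isFiniteMeasure_densityMeasure (integrable_one_sub hν hc hε hε1)

lemma jumpIntensity_eq (hc : IsTruncation ε c) :
    jumpIntensity c ν = (largeJumps c ν).real Set.univ := by
  have h := integral_densityMeasure (μ := ν) (f := fun x => 1 - c x)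
    (by have := hc.measurable; fun_prop)
    (fun x => sub_nonneg.2 (hc.le_one x)) (fun _ => (1 : ℝ))
  simp only [integral_const, smul_eq_mul, mul_one] at h
  exact h.symm

lemma integrable_largeDensity (hν : IsLevyMeasure ν) (hs : HasSmoothDensity ν s)
    (hc : IsTruncation ε c) (hε : 0 < ε) (hε1 : ε < 1) : Integrable (largeDensity c s) := by
  have := isFiniteMeasure_largeJumps hν hc hε hε1
  rw [largeJumps_eq hs hc] at this
  exact integrable_of_isFiniteMeasure_densityMeasure
    (isBddSmooth_largeDensity hs hc hε hε1).continuous.measurable (largeDensity_nonneg hs hc hε)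

/-- The truncation indicator is invisible: c is zero outside |x| ≤ ε < 1. -/
lemma smul_generatorIntegrand (hc : IsTruncation ε c) (hε1 : ε < 1) (g : ℝ → ℝ) (y x : ℝ) :
    c x • (g (y + x) - g y - x * deriv g y) = generatorIntegrand c g y x := by
  rw [generatorIntegrand, smul_eq_mul, mul_comm]
  rcases le_or_gt |x| ε with hx | hx
  · rw [truncId, if_pos (hx.trans hε1.le)]
  · simp [hc.eq_zero hx]

lemma smallGenerator_eq (hc : IsTruncation ε c) (hε1 : ε < 1) :
    smallGenerator b σ c ν = levyGenerator (smallDrift b c ν) σ (smallJumps c ν) := by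
  funext g y
  rw [smallGenerator, levyGenerator, smallJumps,
    integral_densityMeasure hc.measurable hc.nonneg]
  simp_rw [smul_generatorIntegrand hc hε1]

/-- Translation invariance turns the parameter z into a base point of one fixed function, so sup
bounds over the line are bounds uniform in z. -/
lemma levyGenerator_iterate_comp_const_add (β : ℝ) (γ : Measure ℝ) (q : ℕ) (g : ℝ → ℝ)
    (z : ℝ) : (levyGenerator β σ γ)^[q] (fun y => g (z + y))
      = fun y => (levyGenerator β σ γ)^[q] g (z + y) := by
  induction q generalizing g with
  | zero => rfl
  | succ q ih =>
    rw [Function.iterate_succ_apply, Function.iterate_succ_apply, ← ih]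
    congr 1
    funext y
    rw [levyGenerator, levyGenerator, deriv_comp_const_add, iteratedDeriv_comp_const_add]
    simp only [add_assoc]

lemma IsBddSmooth.levyGenerator_iterate {β : ℝ} {γ : Measure ℝ} {g : ℝ → ℝ}
    (hγ : Integrable (fun x : ℝ => x ^ 2) γ) (hg : IsBddSmooth g) (q : ℕ) :
    IsBddSmooth ((_root_.ExpLevy.levyGenerator β σ γ)^[q] g) := by
  induction q generalizing g with
  | zero => exact hg
  | succ q ih => exact ih (hg.levyGenerator β σ hγ)

lemma putSmoothed_eq (k : ℕ) (z : ℝ) :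
    putSmoothed c s k z = fun y => putSmoothed c s k 0 (z + y) := by
  funext y; simp [putSmoothed]

lemma iterCoeff_eq (hc : IsTruncation ε c) (hε1 : ε < 1) (q k : ℕ) (z : ℝ) :
    iterCoeff b σ c s ν q k z = fun y =>
      (levyGenerator (smallDrift b c ν) σ (smallJumps c ν))^[q] (putSmoothed c s k 0) (z + y) := by
  rw [iterCoeff, smallGenerator_eq hc hε1, putSmoothed_eq, levyGenerator_iterate_comp_const_add]

lemma putSmoothed_zero (k : ℕ) : putSmoothed c s k 0
    = fun x => ∫ u, putPayoff (x + u) * convPow (largeDensity c s) k u := by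
  funext x; simp [putSmoothed, putPayoff]

lemma isBddSmooth_putSmoothed (hν : IsLevyMeasure ν) (hs : HasSmoothDensity ν s)
    (hc : IsTruncation ε c) (hε : 0 < ε) (hε1 : ε < 1) {k : ℕ} (hk : 1 ≤ k) :
    IsBddSmooth (putSmoothed c s k 0) := by
  obtain ⟨k, rfl⟩ := Nat.exists_eq_add_of_le' hk
  obtain ⟨h1, h2, -, -⟩ := convPow_succ_spec (isBddSmooth_largeDensity hs hc hε hε1)
    (integrable_largeDensity hν hs hc hε hε1) (largeDensity_nonneg hs hc hε) k
  rw [putSmoothed_zero]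
  exact isBddSmooth_integral_putPayoff h1 h2

lemma putSmoothed_eq_integral (hν : IsLevyMeasure ν) (hs : HasSmoothDensity ν s)
    (hc : IsTruncation ε c) (hε : 0 < ε) (hε1 : ε < 1) {k : ℕ} (hk : 1 ≤ k) (x : ℝ) :
    putSmoothed c s k 0 x = ∫ u, putPayoff (x + u) ∂convPowMeasure (largeJumps c ν) k := by
  obtain ⟨k, rfl⟩ := Nat.exists_eq_add_of_le' hk
  obtain ⟨h1, -, h3, h4⟩ := convPow_succ_spec (isBddSmooth_largeDensity hs hc hε hε1)
    (integrable_largeDensity hν hs hc hε hε1) (largeDensity_nonneg hs hc hε) k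
  rw [putSmoothed_zero, largeJumps_eq hs hc, h4,
    integral_densityMeasure h1.continuous.measurable h3]
  simp [mul_comm]

end triplet

/-! ### Transforms of the approximating laws and their limits. -/

/-- A compound Poisson approximation of the law at time `t` of the Lévy process with drift `β`,
Gaussian part `σ²`, compensated small jumps `γ` and uncompensated large jumps `ρ`. -/
def approxLaw (β σ : ℝ) (γ ρ : Measure ℝ) (δ t : ℝ) : Measure ℝ :=
  (compoundPoisson (jumpApprox β σ γ δ) t).conv (compoundPoisson ρ t)

section

variable {β σ : ℝ} {γ ρ : Measure ℝ} {d : ℕ → ℝ}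

/-- No global bound on φ is required: the jumps stay in the ball of radius `approxRadius`, and
continuous derivatives are bounded there. This admits real exponentials. -/
lemma tendsto_integral_jumpApprox {E : Type*} [NormedAddCommGroup E] [NormedSpace ℝ E]
    [CompleteSpace E] {φ φ₁ φ₂ φ₃ : ℝ → E}
    (hγ : Integrable (fun x : ℝ => x ^ 2) γ) (hγ1 : ∀ᵐ x ∂γ, |x| ≤ 1)
    (hd : ∀ m, 0 < d m ∧ d m ≤ 1) (hd0 : Tendsto d atTop (𝓝 0))
    (h : ∀ x, HasDerivAt φ (φ₁ x) x) (h₁ : ∀ x, HasDerivAt φ₁ (φ₂ x) x)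
    (h₂ : ∀ x, HasDerivAt φ₂ (φ₃ x) x) (h₃ : Continuous φ₃) :
    Tendsto (fun m => ∫ x, (φ x - φ 0) ∂jumpApprox β σ γ (d m)) atTop
      (𝓝 (β • φ₁ 0 + (σ ^ 2 / 2) • φ₂ 0 + ∫ x, (φ x - φ 0 - x • φ₁ 0) ∂γ)) := by
  have hc₂ : Continuous φ₂ := continuous_iff_continuousAt.2 fun x => (h₂ x).continuousAt
  set R := approxRadius β σ γ
  obtain ⟨M₂, hM₂⟩ := (isCompact_Icc (a := -R) (b := R)).exists_bound_of_continuousOn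
    hc₂.continuousOn
  obtain ⟨M₃, hM₃⟩ := (isCompact_Icc (a := -R) (b := R)).exists_bound_of_continuousOn
    h₃.continuousOn
  rw [tendsto_iff_norm_sub_tendsto_zero]
  have hlim := (tendsto_approxError (β := β) (σ := σ) hγ hd hd0).mul_const (max M₂ M₃)
  rw [zero_mul] at hlim
  refine squeeze_zero (fun m => norm_nonneg _) (fun m => ?_) hlim
  exact norm_integral_jumpApprox_sub_le hγ hγ1 (hd m).1 (hd m).2 h h₁ h₂
    (fun x hx => (hM₂ x (abs_le.1 hx)).trans (le_max_left _ _))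
    (fun x hx => (hM₃ x (abs_le.1 hx)).trans (le_max_right _ _))

lemma hasDerivAt_exp_mul (r x : ℝ) :
    HasDerivAt (fun x => Real.exp (r * x)) (r * Real.exp (r * x)) x := by
  have := ((hasDerivAt_id x).const_mul r).exp
  simpa [mul_comm] using this

lemma hasDerivAt_cexp_mul (w : ℂ) (x : ℝ) :
    HasDerivAt (fun x : ℝ => Complex.exp (w * x)) (w * Complex.exp (w * x)) x := by
  have h1 : HasDerivAt (fun x : ℝ => (x : ℂ)) 1 x := Complex.ofRealCLM.hasDerivAt
  have := (h1.const_mul w).cexp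
  simpa [mul_comm] using this

/-- The cumulant function of the small-jump part. -/
def smallCumulant (β σ : ℝ) (γ : Measure ℝ) (r : ℝ) : ℝ :=
  β * r + σ ^ 2 / 2 * r ^ 2 + ∫ x, (Real.exp (r * x) - 1 - x * r) ∂γ

lemma tendsto_integral_exp_jumpApprox (hγ : Integrable (fun x : ℝ => x ^ 2) γ)
    (hγ1 : ∀ᵐ x ∂γ, |x| ≤ 1) (hd : ∀ m, 0 < d m ∧ d m ≤ 1) (hd0 : Tendsto d atTop (𝓝 0)) (r : ℝ) :
    Tendsto (fun m => ∫ x, (Real.exp (r * x) - 1) ∂jumpApprox β σ γ (d m)) atTop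
      (𝓝 (smallCumulant β σ γ r)) := by
  have := tendsto_integral_jumpApprox (β := β) (σ := σ) hγ hγ1 hd hd0
    (φ := fun x => Real.exp (r * x)) (hasDerivAt_exp_mul r)
    (fun x => (hasDerivAt_exp_mul r x).const_mul r)
    (fun x => ((hasDerivAt_exp_mul r x).const_mul r).const_mul r) (by fun_prop)
  simpa [smallCumulant, sq] using this

lemma tendsto_integral_cexp_jumpApprox (hγ : Integrable (fun x : ℝ => x ^ 2) γ)
    (hγ1 : ∀ᵐ x ∂γ, |x| ≤ 1) (hd : ∀ m, 0 < d m ∧ d m ≤ 1) (hd0 : Tendsto d atTop (𝓝 0)) (w : ℂ) :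
    Tendsto (fun m => ∫ x : ℝ, (Complex.exp (w * x) - 1) ∂jumpApprox β σ γ (d m)) atTop
      (𝓝 (β * w + σ ^ 2 / 2 * w ^ 2 + ∫ x : ℝ, (Complex.exp (w * x) - 1 - x * w) ∂γ)) := by
  have := tendsto_integral_jumpApprox (β := β) (σ := σ) hγ hγ1 hd hd0
    (φ := fun x : ℝ => Complex.exp (w * x)) (hasDerivAt_cexp_mul w)
    (fun x => (hasDerivAt_cexp_mul w x).const_mul w)
    (fun x => ((hasDerivAt_cexp_mul w x).const_mul w).const_mul w) (by fun_prop)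
  simpa [sq] using this

lemma integrable_exp_jumpApprox (hγ : Integrable (fun x : ℝ => x ^ 2) γ)
    (hγ1 : ∀ᵐ x ∂γ, |x| ≤ 1) {δ : ℝ} (hδ : 0 < δ) (r : ℝ) :
    Integrable (fun x => Real.exp (r * x)) (jumpApprox β σ γ δ) := by
  refine (integral_jumpApprox hδ ?_).1
  have : IsFiniteMeasure (γ.restrict {x | δ < |x|}) :=
    ⟨by rw [Measure.restrict_apply_univ]; exact measure_lt_abs_lt_top hγ hδ⟩
  refine Integrable.of_bound (by fun_prop) (Real.exp |r|) ?_
  filter_upwards [ae_restrict_of_ae hγ1] with x hx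
  rw [Real.norm_eq_abs, abs_of_pos (Real.exp_pos _)]
  refine Real.exp_le_exp.2 ((le_abs_self _).trans ?_)
  rw [abs_mul]
  exact mul_le_of_le_one_right (abs_nonneg r) hx

lemma isProbabilityMeasure_approxLaw (hγ : Integrable (fun x : ℝ => x ^ 2) γ)
    [IsFiniteMeasure ρ] {δ t : ℝ} (hδ : 0 < δ) (ht : 0 ≤ t) :
    IsProbabilityMeasure (approxLaw β σ γ ρ δ t) := by
  have := isFiniteMeasure_jumpApprox (β := β) (σ := σ) hγ hδ
  have := isProbabilityMeasure_compoundPoisson (η := jumpApprox β σ γ δ) ht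
  have := isProbabilityMeasure_compoundPoisson (η := ρ) ht
  unfold approxLaw
  infer_instance

lemma charFun_approxLaw (hγ : Integrable (fun x : ℝ => x ^ 2) γ)
    [IsFiniteMeasure ρ] {δ t : ℝ} (hδ : 0 < δ) (ht : 0 ≤ t) (u : ℝ) :
    charFun (approxLaw β σ γ ρ δ t) u
      = Complex.exp (t * (∫ x : ℝ, (Complex.exp (u * Complex.I * x) - 1) ∂jumpApprox β σ γ δ
        + ∫ x : ℝ, (Complex.exp (u * Complex.I * x) - 1) ∂ρ)) := by
  have := isFiniteMeasure_jumpApprox (β := β) (σ := σ) hγ hδ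
  have := isProbabilityMeasure_compoundPoisson (η := jumpApprox β σ γ δ) ht
  have := isProbabilityMeasure_compoundPoisson (η := ρ) ht
  rw [approxLaw, charFun_conv, charFun_compoundPoisson ht, charFun_compoundPoisson ht,
    ← Complex.exp_add, ← mul_add]
  simp_rw [mul_right_comm _ _ Complex.I]

lemma lintegral_exp_approxLaw (hγ : Integrable (fun x : ℝ => x ^ 2) γ)
    (hγ1 : ∀ᵐ x ∂γ, |x| ≤ 1) [IsFiniteMeasure ρ] {δ t r : ℝ} (hδ : 0 < δ) (ht : 0 ≤ t)
    (hr : Integrable (fun x => Real.exp (r * x)) ρ) :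
    ∫⁻ x, ENNReal.ofReal (Real.exp (r * x)) ∂approxLaw β σ γ ρ δ t
      = ENNReal.ofReal (Real.exp (t * (∫ x, (Real.exp (r * x) - 1) ∂jumpApprox β σ γ δ
        + ∫ x, (Real.exp (r * x) - 1) ∂ρ))) := by
  have := isFiniteMeasure_jumpApprox (β := β) (σ := σ) hγ hδ
  have := isProbabilityMeasure_compoundPoisson (η := jumpApprox β σ γ δ) ht
  have := isProbabilityMeasure_compoundPoisson (η := ρ) ht
  rw [approxLaw, Measure.lintegral_conv (by fun_prop)]
  simp_rw [mul_add, Real.exp_add, ENNReal.ofReal_mul (Real.exp_pos _).le]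
  have h1 : ∀ x : ℝ, ∫⁻ y, ENNReal.ofReal (Real.exp (r * x)) * ENNReal.ofReal (Real.exp (r * y))
      ∂compoundPoisson ρ t = ENNReal.ofReal (Real.exp (r * x)) *
        ∫⁻ y, ENNReal.ofReal (Real.exp (r * y)) ∂compoundPoisson ρ t :=
    fun x => lintegral_const_mul _ (by fun_prop)
  simp_rw [h1]
  rw [lintegral_mul_const _ (by fun_prop), lintegral_exp_compoundPoisson ht hr,
    lintegral_exp_compoundPoisson ht (integrable_exp_jumpApprox hγ hγ1 hδ r)]

end

/-! ### Passing exponential moments to a weak limit. -/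

/-- Convergence of the first exponential moment under weak convergence, given a bound on the
second one. -/
lemma lintegral_exp_eq_of_tendsto {μ : ℕ → ProbabilityMeasure ℝ} {μ₀ : ProbabilityMeasure ℝ}
    (h : Tendsto μ atTop (𝓝 μ₀)) {a : ℕ → ℝ} {a₀ K : ℝ} (ha : ∀ m, 0 ≤ a m)
    (ha₀ : Tendsto a atTop (𝓝 a₀)) (hK0 : 0 ≤ K)
    (h1 : ∀ m, ∫⁻ x, ENNReal.ofReal (Real.exp x) ∂(μ m : Measure ℝ) = ENNReal.ofReal (a m))
    (h2 : ∀ m, ∫⁻ x, ENNReal.ofReal (Real.exp (2 * x)) ∂(μ m : Measure ℝ) ≤ ENNReal.ofReal K) :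
    ∫⁻ x, ENNReal.ofReal (Real.exp x) ∂(μ₀ : Measure ℝ) = ENNReal.ofReal a₀ := by
  have hint : ∀ m, Integrable Real.exp (μ m : Measure ℝ) ∧ ∫ x, Real.exp x ∂(μ m : Measure ℝ) = a m :=
    fun m => by
      have hi : Integrable Real.exp (μ m : Measure ℝ) := by
        refine ⟨by fun_prop, ?_⟩
        rw [hasFiniteIntegral_iff_ofReal (Eventually.of_forall fun x => (Real.exp_pos x).le), h1]
        exact ENNReal.ofReal_lt_top
      refine ⟨hi, ?_⟩
      rw [integral_eq_lintegral_of_nonneg_ae (Eventually.of_forall fun x => (Real.exp_pos x).le)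
        hi.1, h1, ENNReal.toReal_ofReal (ha m)]
  have hint2 : ∀ m, Integrable (fun x => Real.exp (2 * x)) (μ m : Measure ℝ) ∧
      ∫ x, Real.exp (2 * x) ∂(μ m : Measure ℝ) ≤ K := fun m => by
    have hi : Integrable (fun x => Real.exp (2 * x)) (μ m : Measure ℝ) := by
      refine ⟨by fun_prop, ?_⟩
      rw [hasFiniteIntegral_iff_ofReal (Eventually.of_forall fun x => (Real.exp_pos _).le)]
      exact (h2 m).trans_lt ENNReal.ofReal_lt_top
    refine ⟨hi, ?_⟩
    rw [integral_eq_lintegral_of_nonneg_ae (Eventually.of_forall fun x => (Real.exp_pos _).le)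
      hi.1]
    exact ENNReal.toReal_le_of_le_ofReal hK0 (h2 m)
  have hbd : ∀ R : ℝ, 0 < R → ∀ x, ‖min (Real.exp x) R‖ ≤ R := fun R hR x => by
    rw [Real.norm_of_nonneg (le_min (Real.exp_pos x).le hR.le)]; exact min_le_right _ _
  -- Uniform integrability by truncation: min(e^x, R) is a legitimate test function, and e^x -
  -- min(e^x, R) ≤ e^{2x}/R costs at most K/R for every m. Then R → ∞.
  have htr : ∀ R : ℝ, 0 < R → a₀ - K / R ≤ ∫ x, min (Real.exp x) R ∂(μ₀ : Measure ℝ) ∧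
      ∫ x, min (Real.exp x) R ∂(μ₀ : Measure ℝ) ≤ a₀ := fun R hR => by
    have hlim := (ProbabilityMeasure.tendsto_iff_forall_integral_tendsto.1 h)
      (BoundedContinuousFunction.ofNormedAddCommGroup (fun x => min (Real.exp x) R) (by fun_prop) R
        (hbd R hR))
    simp only [BoundedContinuousFunction.coe_ofNormedAddCommGroup] at hlim
    have hi : ∀ m, Integrable (fun x => min (Real.exp x) R) (μ m : Measure ℝ) := fun m =>
      Integrable.of_bound (by fun_prop) R (Eventually.of_forall (hbd R hR))
    refine ⟨le_of_tendsto_of_tendsto (ha₀.sub_const _) hlim (Eventually.of_forall fun m => ?_),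
      le_of_tendsto_of_tendsto hlim ha₀ (Eventually.of_forall fun m => ?_)⟩
    · have h3 : ∫ x, (Real.exp x - min (Real.exp x) R) ∂(μ m : Measure ℝ)
          ≤ ∫ x, Real.exp (2 * x) / R ∂(μ m : Measure ℝ) := by
        refine integral_mono ((hint m).1.sub (hi m)) ((hint2 m).1.div_const R) fun x => ?_
        have hx := Real.exp_pos x
        simp only
        rw [le_div_iff₀ hR, two_mul, Real.exp_add]
        rcases le_total (Real.exp x) R with h | h
        · rw [min_eq_left h]; simp; positivity
        · rw [min_eq_right h]; nlinarith
      rw [integral_sub (hint m).1 (hi m), (hint m).2, integral_div] at h3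
      have h4 : (∫ x, Real.exp (2 * x) ∂(μ m : Measure ℝ)) / R ≤ K / R := by
        gcongr; exact (hint2 m).2
      simp only
      linarith
    · rw [← (hint m).2]
      exact integral_mono (hi m) (hint m).1 fun x => min_le_left _ _
  have hmono : Tendsto (fun N : ℕ => ∫⁻ x, ENNReal.ofReal (min (Real.exp x) (N + 1))
      ∂(μ₀ : Measure ℝ)) atTop (𝓝 (∫⁻ x, ENNReal.ofReal (Real.exp x) ∂(μ₀ : Measure ℝ))) := by
    refine lintegral_tendsto_of_tendsto_of_monotone (fun N => by fun_prop)
      (Eventually.of_forall fun x N N' hN => ?_) (Eventually.of_forall fun x => ?_)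
    · refine ENNReal.ofReal_le_ofReal (min_le_min le_rfl ?_)
      have : (N : ℝ) ≤ N' := by exact_mod_cast hN
      linarith
    · refine tendsto_const_nhds.congr' ?_
      filter_upwards [eventually_ge_atTop ⌈Real.exp x⌉₊] with N hN
      rw [min_eq_left]
      have := Nat.le_ceil (Real.exp x)
      have : (⌈Real.exp x⌉₊ : ℝ) ≤ N := by exact_mod_cast hN
      linarith
  have hreal : Tendsto (fun N : ℕ => ∫ x, min (Real.exp x) ((N : ℝ) + 1) ∂(μ₀ : Measure ℝ)) atTop
      (𝓝 a₀) := by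
    have h5 : Tendsto (fun N : ℕ => a₀ - K / ((N : ℝ) + 1)) atTop (𝓝 a₀) := by
      have := (tendsto_one_div_add_atTop_nhds_zero_nat (𝕜 := ℝ)).const_mul K
      simpa [div_eq_mul_inv] using this.const_sub a₀
    exact tendsto_of_tendsto_of_tendsto_of_le_of_le h5 tendsto_const_nhds
      (fun N => (htr _ (by positivity)).1) (fun N => (htr _ (by positivity)).2)
  refine tendsto_nhds_unique hmono ((ENNReal.tendsto_ofReal hreal).congr fun N => ?_)
  refine ofReal_integral_eq_lintegral_ofReal ?_ (Eventually.of_forall fun x =>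
    le_min (Real.exp_pos x).le (by positivity))
  exact Integrable.of_bound (by fun_prop) _ (Eventually.of_forall (hbd _ (by positivity)))

/-! ### The Lévy–Khintchine exponent and the martingale condition after splitting. -/

section triplet

variable {b σ ε : ℝ} {c s : ℝ → ℝ} {ν : Measure ℝ}

lemma measurable_truncId : Measurable truncId :=
  Measurable.ite (measurableSet_le (by fun_prop) measurable_const) measurable_id measurable_const

lemma abs_truncId_le (x : ℝ) : |truncId x| ≤ 1 := by
  unfold truncId; split_ifs with h <;> simp [h]

lemma integral_truncId_largeJumps (hc : IsTruncation ε c) :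
    ∫ x, truncId x ∂largeJumps c ν = b - smallDrift b c ν := by
  rw [largeJumps, integral_densityMeasure (by have := hc.measurable; fun_prop)
    (fun x => sub_nonneg.2 (hc.le_one x)), smallDrift, sub_sub_cancel,
    ← integral_indicator measurableSet_Icc]
  refine integral_congr_ae (Eventually.of_forall fun x => ?_)
  simp only [Set.indicator_apply, truncId, Set.mem_Icc, ← abs_le]
  split_ifs <;> simp [mul_comm]

/-- Splitting a Lévy–Khintchine integral into small and large jumps. -/
lemma integral_truncId_eq {E : Type*} [NormedAddCommGroup E] [NormedSpace ℝ E] [CompleteSpace E]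
    (hν : IsLevyMeasure ν)
    (hc : IsTruncation ε c) (hε : 0 < ε) (hε1 : ε < 1) {φ : ℝ → E} {v : E}
    (h1 : Integrable (fun x => φ x - x • v) (smallJumps c ν))
    (h2 : Integrable φ (largeJumps c ν)) :
    ∫ x, (φ x - truncId x • v) ∂ν = (∫ x, (φ x - x • v) ∂smallJumps c ν)
      + ∫ x, φ x ∂largeJumps c ν - (b - smallDrift b c ν) • v := by
  have := isFiniteMeasure_largeJumps hν hc hε hε1
  have hae : (fun x => φ x - truncId x • v) =ᵐ[smallJumps c ν] fun x => φ x - x • v := by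
    filter_upwards [ae_abs_le_smallJumps (ν := ν) hc] with x hx
    rw [truncId, if_pos (hx.trans hε1.le)]
  have ht : Integrable (fun x => truncId x • v) (largeJumps c ν) :=
    (Integrable.of_bound measurable_truncId.aestronglyMeasurable 1
      (Eventually.of_forall abs_truncId_le)).smul_const v
  conv_lhs => rw [← smallJumps_add_largeJumps (ν := ν) hc]
  rw [integral_add_measure (h1.congr hae.symm) (h2.sub ht), integral_congr_ae hae,
    integral_sub h2 ht, integral_smul_const, integral_truncId_largeJumps (b := b) hc]
  abel

lemma integrable_taylor_smallJumps {E : Type*} [NormedAddCommGroup E] [NormedSpace ℝ E]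
    {γ : Measure ℝ} (hγ : Integrable (fun x : ℝ => x ^ 2) γ) (hγ1 : ∀ᵐ x ∂γ, |x| ≤ 1)
    {φ φ₁ φ₂ : ℝ → E} (h : ∀ x, HasDerivAt φ (φ₁ x) x) (h₁ : ∀ x, HasDerivAt φ₁ (φ₂ x) x)
    (h₂ : Continuous φ₂) : Integrable (fun x => φ x - φ 0 - x • φ₁ 0) γ := by
  obtain ⟨M, hM⟩ := (isCompact_Icc (a := (-1 : ℝ)) (b := 1)).exists_bound_of_continuousOn
    h₂.continuousOn
  have hcont : Continuous φ := continuous_iff_continuousAt.2 fun x => (h x).continuousAt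
  refine (hγ.const_mul M).mono' (by fun_prop) ?_
  filter_upwards [hγ1] with x hx
  exact norm_taylor_one_le (R := 1) (fun x _ => h x) (fun x _ => h₁ x)
    (fun x hx => hM x (abs_le.1 hx)) hx

/-- The exponent is put in the shape of the limit of the approximating exponents: compensated small
jumps, uncompensated large ones, and the compensator of the latter moved into the drift. -/
lemma levyExponent_eq (hν : IsLevyMeasure ν) (hc : IsTruncation ε c) (hε : 0 < ε) (hε1 : ε < 1)
    (u : ℝ) : levyExponent b σ ν u = smallDrift b c ν * (u * Complex.I)
      + (σ : ℂ) ^ 2 / 2 * (u * Complex.I) ^ 2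
      + (∫ x : ℝ, (Complex.exp (u * Complex.I * x) - 1 - x * (u * Complex.I)) ∂smallJumps c ν)
      + ∫ x : ℝ, (Complex.exp (u * Complex.I * x) - 1) ∂largeJumps c ν := by
  have := isFiniteMeasure_largeJumps hν hc hε hε1
  have hγ := integrable_sq_smallJumps hν hc hε1
  have hγ1 : ∀ᵐ x ∂smallJumps c ν, |x| ≤ 1 :=
    (ae_abs_le_smallJumps hc).mono fun x hx => hx.trans hε1.le
  have h1 := integrable_taylor_smallJumps hγ hγ1 (hasDerivAt_cexp_mul (u * Complex.I))
    (fun x => (hasDerivAt_cexp_mul (u * Complex.I) x).const_mul (u * Complex.I)) (by fun_prop)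
  simp only [Complex.ofReal_zero, mul_zero, Complex.exp_zero, mul_one] at h1
  have h2 : Integrable (fun x : ℝ => Complex.exp (u * Complex.I * x) - 1) (largeJumps c ν) := by
    refine Integrable.of_bound (by fun_prop) 2 (Eventually.of_forall fun x => ?_)
    refine (norm_sub_le _ _).trans ?_
    rw [mul_right_comm, ← Complex.ofReal_mul, Complex.norm_exp_ofReal_mul_I]
    norm_num
  have key := integral_truncId_eq (b := b) hν hc hε hε1 h1 h2
  simp only [Complex.real_smul] at key
  have e : ∫ z : ℝ, (Complex.exp (Complex.I * u * z) - 1 - Complex.I * u * truncId z) ∂ν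
      = ∫ z : ℝ, (Complex.exp (u * Complex.I * z) - 1 - truncId z * (u * Complex.I)) ∂ν := by
    refine integral_congr_ae (Eventually.of_forall fun z => ?_)
    simp only
    rw [mul_comm Complex.I (u : ℂ)]; ring
  rw [levyExponent, e, key, mul_pow, Complex.I_sq]
  push_cast
  ring

/-- Needed for r = 1 (the mean of e^{Z_t}) and r = 2 (uniform integrability in the limit); κ > 2
covers both. -/
lemma integrable_exp_mul_largeJumps (hν : IsLevyMeasure ν) (hc : IsTruncation ε c) (hε : 0 < ε)
    (hε1 : ε < 1)
    (hexp : ∃ κ : ℝ, 2 < κ ∧ IntegrableOn (fun z : ℝ => Real.exp (κ * |z|)) {z : ℝ | 1 < |z|} ν)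
    {r : ℝ} (hr0 : 0 ≤ r) (hr : r ≤ 2) :
    Integrable (fun x => Real.exp (r * x)) (largeJumps c ν) := by
  obtain ⟨κ, hκ, hi⟩ := hexp
  have := hc.measurable
  have hm : Measurable fun x => 1 - c x := by fun_prop
  rw [largeJumps, integrable_densityMeasure_iff hm (fun x => sub_nonneg.2 (hc.le_one x))]
  have hset : MeasurableSet {z : ℝ | 1 < |z|} := measurableSet_lt_abs 1
  refine (((integrable_one_sub hν hc hε hε1).const_mul (Real.exp 2)).add
    (hi.integrable_indicator hset)).mono' (by simp only [smul_eq_mul]; fun_prop)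
    (Eventually.of_forall fun x => ?_)
  have hc1 := hc.le_one x
  have hc0 := hc.nonneg x
  rw [smul_eq_mul, Real.norm_eq_abs, abs_of_nonneg (mul_nonneg (sub_nonneg.2 hc1)
    (Real.exp_pos _).le), Pi.add_apply]
  have hrx : r * x ≤ r * |x| := mul_le_mul_of_nonneg_left (le_abs_self x) hr0
  rcases le_or_gt |x| 1 with hx | hx
  · rw [Set.indicator_of_notMem (by simpa using hx), add_zero, mul_comm]
    refine mul_le_mul_of_nonneg_right (Real.exp_le_exp.2 ?_) (sub_nonneg.2 hc1)
    nlinarith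
  · rw [Set.indicator_of_mem (by exact hx)]
    have h3 : Real.exp (r * x) ≤ Real.exp (κ * |x|) := by
      refine Real.exp_le_exp.2 (hrx.trans ?_)
      gcongr; linarith
    have h4 : (1 - c x) * Real.exp (r * x) ≤ Real.exp (r * x) :=
      mul_le_of_le_one_left (Real.exp_pos _).le (by linarith)
    have h5 : 0 ≤ Real.exp 2 * (1 - c x) := mul_nonneg (Real.exp_pos _).le (sub_nonneg.2 hc1)
    linarith

/-- The martingale condition says precisely that the total cumulant function vanishes at 1. -/
lemma smallCumulant_one_add (hν : IsLevyMeasure ν) (hc : IsTruncation ε c) (hε : 0 < ε)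
    (hε1 : ε < 1)
    (hexp : ∃ κ : ℝ, 2 < κ ∧ IntegrableOn (fun z : ℝ => Real.exp (κ * |z|)) {z : ℝ | 1 < |z|} ν)
    (hb : b = -(σ ^ 2 / 2) - ∫ z, (Real.exp z - 1 - truncId z) ∂ν) :
    smallCumulant (smallDrift b c ν) σ (smallJumps c ν) 1
      + ∫ x, (Real.exp (1 * x) - 1) ∂largeJumps c ν = 0 := by
  have := isFiniteMeasure_largeJumps hν hc hε hε1
  have hγ := integrable_sq_smallJumps hν hc hε1
  have hγ1 : ∀ᵐ x ∂smallJumps c ν, |x| ≤ 1 :=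
    (ae_abs_le_smallJumps hc).mono fun x hx => hx.trans hε1.le
  have h1 := integrable_taylor_smallJumps hγ hγ1 (hasDerivAt_exp_mul 1)
    (fun x => (hasDerivAt_exp_mul 1 x).const_mul 1) (by fun_prop)
  simp only [mul_zero, Real.exp_zero, one_mul] at h1
  have h2 : Integrable (fun x : ℝ => Real.exp x - 1) (largeJumps c ν) := by
    have := integrable_exp_mul_largeJumps hν hc hε hε1 hexp zero_le_one one_le_two
    simp only [one_mul] at this
    exact this.sub (integrable_const _)
  have key := integral_truncId_eq (b := b) hν hc hε hε1 h1 h2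
  simp only [smul_eq_mul, mul_one] at key
  rw [smallCumulant]
  simp only [one_mul, mul_one, one_pow]
  linarith

end triplet

/-! ### Conditioning on large jumps, regrouping the series, and the large deviation bound. -/

/-- Conditioning on the number of large jumps. -/
lemma hasSum_integral_conv_compoundPoisson {η ρ : Measure ℝ} [IsFiniteMeasure η]
    [IsFiniteMeasure ρ] {g : ℝ → ℝ} (hg : Continuous g) {M : ℝ} (hM : ∀ x, |g x| ≤ M) {t : ℝ}
    (ht : 0 ≤ t) :
    HasSum (fun k : ℕ => Real.exp (-(t * ρ.real Set.univ)) * (t ^ k / k.factorial) *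
      ∫ x, ∫ u, g (x + u) ∂convPowMeasure ρ k ∂compoundPoisson η t)
      (∫ x, g x ∂(compoundPoisson η t).conv (compoundPoisson ρ t)) := by
  have := isProbabilityMeasure_compoundPoisson (η := η) ht
  have := isProbabilityMeasure_compoundPoisson (η := ρ) ht
  have hsm : StronglyMeasurable fun u => ∫ x, g (u + x) ∂compoundPoisson η t :=
    (Continuous.stronglyMeasurable (f := fun p : ℝ × ℝ => g (p.1 + p.2))
      (by fun_prop)).integral_prod_right
  have hbd : ∀ u, ‖∫ x, g (u + x) ∂compoundPoisson η t‖ ≤ M := fun u => by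
    simpa using norm_integral_le_of_norm_le_const (μ := compoundPoisson η t)
      (f := fun x => g (u + x)) (Eventually.of_forall fun x => hM _)
  have h := hasSum_integral_compoundPoisson ht (integrable_compoundPoisson (η := ρ) ht hsm hbd)
  rw [Measure.conv_comm, integral_conv (Integrable.of_bound hg.aestronglyMeasurable M
    (Eventually.of_forall hM))]
  have e : ∀ k, ∫ x, ∫ u, g (x + u) ∂convPowMeasure ρ k ∂compoundPoisson η t
      = ∫ u, ∫ x, g (u + x) ∂compoundPoisson η t ∂convPowMeasure ρ k := fun k => ?_
  · simp_rw [e]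
    exact h
  rw [integral_integral_swap]
  · simp_rw [add_comm]
  · exact Integrable.of_bound (Continuous.aestronglyMeasurable
      (f := fun p : ℝ × ℝ => g (p.1 + p.2)) (by fun_prop)) M (Eventually.of_forall fun p => hM _)

/-- Truncating an exponential series. -/
lemma abs_sub_sum_Icc_le {a T : ℕ → ℝ} {Λ t S : ℝ} (n : ℕ) (hΛ : 0 ≤ Λ) (ht : 0 ≤ t)
    (ht1 : t ≤ 1) (ha : ∀ k, |a k| ≤ Λ ^ k)
    (hS : HasSum (fun k : ℕ => Real.exp (-(t * Λ)) * (t ^ k / k.factorial) * a k) S) :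
    |S - Real.exp (-(t * Λ)) * ∑ k ∈ Finset.Icc 1 n, t ^ k / k.factorial * T k|
      ≤ |a 0| + ∑ k ∈ Finset.Icc 1 n, t ^ k / k.factorial * |a k - T k|
        + t ^ (n + 1) * Real.exp Λ := by
  set E := Real.exp (-(t * Λ)) with hE
  have hE0 : 0 ≤ E := (Real.exp_pos _).le
  have hE1 : E ≤ 1 := Real.exp_le_one_iff.2 (by have := mul_nonneg ht hΛ; linarith)
  have hexp : HasSum (fun k : ℕ => Λ ^ k / (k.factorial : ℝ)) (Real.exp Λ) := by
    rw [Real.exp_eq_exp_ℝ]; exact NormedSpace.expSeries_div_hasSum_exp Λ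
  have htail : |∑' i : ℕ, E * (t ^ (i + (n + 1)) / (i + (n + 1)).factorial) * a (i + (n + 1))|
      ≤ t ^ (n + 1) * Real.exp Λ := by
    have hsum : Summable fun i : ℕ => Λ ^ (i + (n + 1)) / ((i + (n + 1)).factorial : ℝ) :=
      (summable_nat_add_iff (n + 1)).2 hexp.summable
    have h1 : ∑' i : ℕ, Λ ^ (i + (n + 1)) / ((i + (n + 1)).factorial : ℝ) ≤ Real.exp Λ := by
      rw [← hexp.tsum_eq, ← hexp.summable.sum_add_tsum_nat_add (n + 1)]
      have : 0 ≤ ∑ i ∈ Finset.range (n + 1), Λ ^ i / (i.factorial : ℝ) :=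
        Finset.sum_nonneg fun i _ => by positivity
      linarith
    refine (tsum_of_norm_bounded (E := ℝ) (f := fun i : ℕ => E *
      (t ^ (i + (n + 1)) / (i + (n + 1)).factorial) * a (i + (n + 1))) (hsum.hasSum.mul_left (t ^ (n + 1))) fun i => ?_).trans
      (mul_le_mul_of_nonneg_left h1 (by positivity))
    rw [Real.norm_eq_abs, abs_mul, abs_of_nonneg (by positivity)]
    have h2 : t ^ (i + (n + 1)) ≤ t ^ (n + 1) := pow_le_pow_of_le_one ht ht1 (by omega)
    calc E * (t ^ (i + (n + 1)) / (i + (n + 1)).factorial) * |a (i + (n + 1))|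
        ≤ 1 * (t ^ (n + 1) / (i + (n + 1)).factorial) * Λ ^ (i + (n + 1)) := by
          gcongr
          exact ha _
      _ = _ := by ring
  have hsplit := hS.summable.sum_add_tsum_nat_add (n + 1)
  rw [hS.tsum_eq, Finset.range_eq_Ico, Finset.sum_eq_sum_Ico_succ_bot (by omega)] at hsplit
  have hI : Finset.Ico (0 + 1) (n + 1) = Finset.Icc 1 n := by ext; simp [Nat.succ_le_iff]
  rw [hI] at hsplit
  have hrw : S - E * ∑ k ∈ Finset.Icc 1 n, t ^ k / k.factorial * T k
      = E * a 0 + (∑ k ∈ Finset.Icc 1 n, E * (t ^ k / k.factorial * (a k - T k)))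
        + ∑' i : ℕ, E * (t ^ (i + (n + 1)) / (i + (n + 1)).factorial) * a (i + (n + 1)) := by
    rw [← hsplit, Finset.mul_sum]
    simp only [mul_sub, Finset.sum_sub_distrib, mul_assoc]
    simp
    ring
  rw [hrw]
  refine (abs_add_le _ _).trans (add_le_add ((abs_add_le _ _).trans (add_le_add ?_ ?_)) htail)
  · rw [abs_mul, abs_of_nonneg hE0]
    exact mul_le_of_le_one_left (abs_nonneg _) hE1
  · refine (Finset.abs_sum_le_sum_abs _ _).trans (Finset.sum_le_sum fun k _ => ?_)
    rw [abs_mul, abs_mul, abs_of_nonneg hE0, abs_of_nonneg (by positivity : 0 ≤ t ^ k / (k.factorial : ℝ))]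
    exact mul_le_of_le_one_left (by positivity) hE1

/-- Set j = k + q and use binom(k+q, k)/(k+q)! = 1/(k! q!). The constraint j ≤ n becomes q < n + 1 -
k, the Taylor order used for k large jumps. -/
lemma sum_Icc_choose_mul_eq (G : ℕ → ℕ → ℝ) (n : ℕ) (t : ℝ) :
    ∑ j ∈ Finset.Icc 1 n, (∑ k ∈ Finset.Icc 1 j, (j.choose k : ℝ) * G (j - k) k) *
      (t ^ j / j.factorial)
    = ∑ k ∈ Finset.Icc 1 n, t ^ k / k.factorial *
        ∑ q ∈ Finset.range (n + 1 - k), t ^ q / q.factorial * G q k := by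
  simp_rw [Finset.sum_mul]
  rw [Finset.sum_comm' (t' := Finset.Icc 1 n) (s' := fun k => Finset.Ico k (n + 1))
    (by intro j k; simp only [Finset.mem_Icc, Finset.mem_Ico]; omega)]
  refine Finset.sum_congr rfl fun k _ => ?_
  rw [Finset.sum_Ico_eq_sum_range, Finset.mul_sum]
  refine Finset.sum_congr rfl fun q _ => ?_
  have h := Nat.add_choose_mul_factorial_mul_factorial q k
  rw [add_comm q k, mul_right_comm] at h
  have h' : (((k + q).choose k : ℕ) : ℝ) * k.factorial * q.factorial = (k + q).factorial := by
    exact_mod_cast h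
  have h1 : (k.factorial : ℝ) ≠ 0 := by positivity
  have h2 : (q.factorial : ℝ) ≠ 0 := by positivity
  have h3 : ((k + q).factorial : ℝ) ≠ 0 := by positivity
  rw [Nat.add_sub_cancel_left, pow_add]
  field_simp
  rw [← h']; ring

/-- A large deviation bound for a process with jumps bounded by `ε`. -/
lemma exists_exp_smallCumulant_le {β σ ε ε' : ℝ} {γ : Measure ℝ}
    (hγ : Integrable (fun x : ℝ => x ^ 2) γ) (hγε : ∀ᵐ x ∂γ, |x| ≤ ε) (hε : 0 < ε)
    (hεε' : ε < ε') :
    ∃ C, ∀ t, 0 < t → t ≤ 1 → t * smallCumulant β σ γ (-(-Real.log t / ε')) ≤ C := by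
  have hε' : 0 < ε' := hε.trans hεε'
  set V := ∫ x, x ^ 2 ∂γ with hV
  have hV0 : 0 ≤ V := integral_nonneg fun x => sq_nonneg x
  refine ⟨|β| * (1 / ε') + σ ^ 2 / 2 * (2 / ε' ^ 2) + V * (2 / (ε' - ε) ^ 2), fun t ht ht1 => ?_⟩
  set r := -Real.log t / ε' with hr
  have hr0 : 0 ≤ r := div_nonneg (neg_nonneg.2 (Real.log_nonpos ht.le ht1)) hε'.le
  have htr : t = Real.exp (-(r * ε')) := by
    rw [hr, div_mul_cancel₀ _ hε'.ne', neg_neg, Real.exp_log ht]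
  have hquad : ∀ a : ℝ, 0 < a → r ^ 2 * Real.exp (-(r * a)) ≤ 2 / a ^ 2 := fun a ha => by
    have h1 := Real.quadratic_le_exp_of_nonneg (mul_nonneg hr0 ha.le)
    rw [Real.exp_neg, ← div_eq_mul_inv, div_le_div_iff₀ (Real.exp_pos _) (by positivity)]
    have : 0 ≤ r * a := mul_nonneg hr0 ha.le
    nlinarith
  have hlin : r * Real.exp (-(r * ε')) ≤ 1 / ε' := by
    have h1 := Real.add_one_le_exp (r * ε')
    rw [Real.exp_neg, ← div_eq_mul_inv, div_le_div_iff₀ (Real.exp_pos _) hε']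
    linarith
  have hjump : ∫ x, (Real.exp (-r * x) - 1 - x * -r) ∂γ ≤ r ^ 2 * Real.exp (r * ε) * V := by
    rw [hV, ← integral_const_mul]
    refine (le_abs_self _).trans (norm_integral_le_of_norm_le
      (f := fun x => Real.exp (-r * x) - 1 - x * -r) (hγ.const_mul _) ?_)
    filter_upwards [hγε] with x hx
    have := norm_taylor_one_le (R := ε) (φ := fun x => Real.exp (-r * x))
      (fun x _ => hasDerivAt_exp_mul (-r) x)
      (fun x _ => (hasDerivAt_exp_mul (-r) x).const_mul (-r)) (M := r ^ 2 * Real.exp (r * ε))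
      (fun x hx => by
        rw [← mul_assoc, ← sq, neg_sq, Real.norm_of_nonneg (by positivity)]
        refine mul_le_mul_of_nonneg_left (Real.exp_le_exp.2 ?_) (sq_nonneg r)
        have := neg_abs_le x
        nlinarith) hx
    simpa using this
  have hcum : smallCumulant β σ γ (-r)
      ≤ |β| * r + σ ^ 2 / 2 * r ^ 2 + r ^ 2 * Real.exp (r * ε) * V := by
    rw [smallCumulant, neg_sq]
    have : β * -r ≤ |β| * r := by have := neg_abs_le β; nlinarith
    linarith
  refine (mul_le_mul_of_nonneg_left hcum ht.le).trans ?_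
  -- With t = e^{-rε'}, the growth e^{rε} caused by jumps of size up to ε is beaten by t because ε <
  -- ε'; the remaining powers of r are absorbed by the decaying exponentials.
  have e1 : t * Real.exp (r * ε) = Real.exp (-(r * (ε' - ε))) := by
    rw [htr, ← Real.exp_add]; congr 1; ring
  calc t * (|β| * r + σ ^ 2 / 2 * r ^ 2 + r ^ 2 * Real.exp (r * ε) * V)
      = |β| * (r * t) + σ ^ 2 / 2 * (r ^ 2 * t) + V * (r ^ 2 * (t * Real.exp (r * ε))) := by ring
    _ = |β| * (r * Real.exp (-(r * ε'))) + σ ^ 2 / 2 * (r ^ 2 * Real.exp (-(r * ε')))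
        + V * (r ^ 2 * Real.exp (-(r * (ε' - ε)))) := by rw [e1, ← htr]
    _ ≤ _ := by
        have := hquad ε' hε'
        have := hquad (ε' - ε) (sub_pos.2 hεε')
        gcongr

/-! ### Identification of the law of Z_t, mean one, and put-call parity. -/

section triplet

variable {Ω : Type*} [MeasurableSpace Ω] {P : Measure Ω} [IsProbabilityMeasure P]
  {Z : ℝ≥0 → Ω → ℝ} {b σ ε : ℝ} {c s : ℝ → ℝ} {ν : Measure ℝ} {d : ℕ → ℝ}

/-- Lévy's continuity theorem: the characteristic exponents converge, and the limit is the exponent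
of the triplet. -/
lemma tendsto_approxLaw (hZ : IsLevyProcessWithTriplet Z P b σ ν) (hc : IsTruncation ε c)
    (hε : 0 < ε) (hε1 : ε < 1) (hd : ∀ m, 0 < d m ∧ d m ≤ 1) (hd0 : Tendsto d atTop (𝓝 0))
    (t : ℝ≥0) {μ : ℕ → ProbabilityMeasure ℝ} {μ₀ : ProbabilityMeasure ℝ}
    (hμ : ∀ m, (μ m : Measure ℝ)
      = approxLaw (smallDrift b c ν) σ (smallJumps c ν) (largeJumps c ν) (d m) t)
    (hμ₀ : (μ₀ : Measure ℝ) = P.map (Z t)) : Tendsto μ atTop (𝓝 μ₀) := by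
  have hν := hZ.levyMeasure
  have := isFiniteMeasure_largeJumps hν hc hε hε1
  have hγ := integrable_sq_smallJumps hν hc hε1
  have hγ1 : ∀ᵐ x ∂smallJumps c ν, |x| ≤ 1 :=
    (ae_abs_le_smallJumps hc).mono fun x hx => hx.trans hε1.le
  rw [ProbabilityMeasure.tendsto_iff_tendsto_charFun]
  intro u
  rw [hμ₀, hZ.charFun_eq, levyExponent_eq hν hc hε hε1]
  refine ((Complex.continuous_exp.tendsto _).comp (((tendsto_integral_cexp_jumpApprox hγ hγ1 hd hd0
    (u * Complex.I)).add_const _).const_mul (t : ℂ))).congr fun m => ?_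
  rw [hμ, charFun_approxLaw hγ (hd m).1 t.coe_nonneg]
  rfl

lemma tendsto_inv_nat_add_one :
    (∀ m : ℕ, 0 < 1 / ((m : ℝ) + 1) ∧ 1 / ((m : ℝ) + 1) ≤ 1) ∧
      Tendsto (fun m : ℕ => 1 / ((m : ℝ) + 1)) atTop (𝓝 0) :=
  ⟨fun m => ⟨by positivity, by rw [div_le_one (by positivity)]; simp⟩,
    tendsto_one_div_add_atTop_nhds_zero_nat⟩

/-- Under the martingale condition, `exp Z_t` is integrable with mean one. -/
lemma integrable_exp_and_integral_eq_one (hZ : IsLevyProcessWithTriplet Z P b σ ν)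
    (hc : IsTruncation ε c) (hε : 0 < ε) (hε1 : ε < 1)
    (hexp : ∃ κ : ℝ, 2 < κ ∧ IntegrableOn (fun z : ℝ => Real.exp (κ * |z|)) {z : ℝ | 1 < |z|} ν)
    (hb : b = -(σ ^ 2 / 2) - ∫ z, (Real.exp z - 1 - truncId z) ∂ν) (t : ℝ≥0) :
    Integrable (fun w => Real.exp (Z t w)) P ∧ ∫ w, Real.exp (Z t w) ∂P = 1 := by
  have hν := hZ.levyMeasure
  have := isFiniteMeasure_largeJumps hν hc hε hε1
  have hγ := integrable_sq_smallJumps hν hc hε1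
  have hγ1 : ∀ᵐ x ∂smallJumps c ν, |x| ≤ 1 :=
    (ae_abs_le_smallJumps hc).mono fun x hx => hx.trans hε1.le
  obtain ⟨hd, hd0⟩ := tendsto_inv_nat_add_one
  have hm := hZ.levyProcess.measurable t
  let μ : ℕ → ProbabilityMeasure ℝ := fun m =>
    ⟨approxLaw (smallDrift b c ν) σ (smallJumps c ν) (largeJumps c ν) (1 / ((m : ℝ) + 1)) t,
      isProbabilityMeasure_approxLaw hγ (hd m).1 t.coe_nonneg⟩
  let μ₀ : ProbabilityMeasure ℝ := ⟨P.map (Z t), Measure.isProbabilityMeasure_map hm.aemeasurable⟩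
  have hlim : Tendsto μ atTop (𝓝 μ₀) :=
    tendsto_approxLaw hZ hc hε hε1 hd hd0 t (fun m => rfl) rfl
  have hcum := fun r : ℝ => (Real.continuous_exp.tendsto _).comp
    (((tendsto_integral_exp_jumpApprox (β := smallDrift b c ν) (σ := σ) hγ hγ1 hd hd0 r).add_const
      (∫ x, (Real.exp (r * x) - 1) ∂largeJumps c ν)).const_mul (t : ℝ))
  have h1 := hcum 1
  rw [smallCumulant_one_add hν hc hε hε1 hexp hb, mul_zero, Real.exp_zero] at h1
  -- The second exponential moments of the approximations converge, hence are bounded; this supplies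
  -- the uniform integrability.
  obtain ⟨K, hK⟩ := (hcum 2).bddAbove_range
  have key := lintegral_exp_eq_of_tendsto hlim (fun m => (Real.exp_pos _).le) h1
    ((Real.exp_pos _).le.trans (hK ⟨0, rfl⟩)) (fun m => by
      have := lintegral_exp_approxLaw (β := smallDrift b c ν) (σ := σ) hγ hγ1 (hd m).1 t.coe_nonneg
        (integrable_exp_mul_largeJumps hν hc hε hε1 hexp zero_le_one one_le_two)
      simp only [one_mul] at this
      simp only [one_mul]
      exact this) (fun m => by
      have := lintegral_exp_approxLaw (β := smallDrift b c ν) (σ := σ) hγ hγ1 (hd m).1 t.coe_nonneg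
        (integrable_exp_mul_largeJumps hν hc hε hε1 hexp zero_le_two le_rfl)
      refine (le_of_eq this).trans (ENNReal.ofReal_le_ofReal (hK ⟨m, rfl⟩)))
  change ∫⁻ x, ENNReal.ofReal (Real.exp x) ∂(P.map (Z t)) = ENNReal.ofReal 1 at key
  rw [lintegral_map (by fun_prop) hm] at key
  have hi : Integrable (fun w => Real.exp (Z t w)) P := by
    refine ⟨by fun_prop, ?_⟩
    rw [hasFiniteIntegral_iff_ofReal (Eventually.of_forall fun x => (Real.exp_pos _).le), key]
    exact ENNReal.ofReal_lt_top
  refine ⟨hi, ?_⟩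
  rw [integral_eq_lintegral_of_nonneg_ae (Eventually.of_forall fun x => (Real.exp_pos _).le)
    hi.1, key, ENNReal.toReal_ofReal zero_le_one]

lemma callPayoff_eq (z x : ℝ) :
    callPayoff z x = Real.exp z * Real.exp x - 1 + putPayoff (z + x) := by
  rw [callPayoff, putPayoff, ← Real.exp_add]
  rcases le_total (Real.exp (z + x) - 1) 0 with h | h
  · rw [max_eq_right h, max_eq_left (by linarith)]; ring
  · rw [max_eq_left h, max_eq_right (by linarith)]; ring

lemma integrable_callPayoff {X : Ω → ℝ} (hm : Measurable X)
    (hi : Integrable (fun w => Real.exp (X w)) P) (z : ℝ) :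
    Integrable (fun w => putPayoff (z + X w)) P ∧ Integrable (fun w => callPayoff z (X w)) P := by
  have h1 : Integrable (fun w => putPayoff (z + X w)) P :=
    Integrable.of_bound (continuous_putPayoff.measurable.comp
      (hm.const_add z)).aestronglyMeasurable 1 (Eventually.of_forall fun w => abs_putPayoff_le _)
  refine ⟨h1, ?_⟩
  simp_rw [callPayoff_eq]
  exact ((hi.const_mul _).sub (integrable_const _)).add h1

/-- Put-call parity. -/
lemma callPrice_eq {t : ℝ≥0} (hm : Measurable (Z t))
    (hi : Integrable (fun w => Real.exp (Z t w)) P) (h1 : ∫ w, Real.exp (Z t w) ∂P = 1) (z : ℝ) :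
    callPrice P Z t z = Real.exp z - 1 + ∫ w, putPayoff (z + Z t w) ∂P := by
  rw [callPrice]
  simp_rw [callPayoff_eq]
  rw [integral_add (f := fun w => Real.exp z * Real.exp (Z t w) - 1)
    ((hi.const_mul _).sub (integrable_const _)) (integrable_callPayoff hm hi z).1,
    integral_sub (hi.const_mul _) (integrable_const _), integral_const_mul, h1]
  simp

end triplet

/-! ### Small-time expansion of the put price. -/

section triplet

variable {Ω : Type*} [MeasurableSpace Ω] {P : Measure Ω} [IsProbabilityMeasure P]
  {Z : ℝ≥0 → Ω → ℝ} {b σ ε : ℝ} {c s : ℝ → ℝ} {ν : Measure ℝ}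

/-- The no-large-jump contribution to the put price of an approximating process. -/
lemma integral_putPayoff_compoundPoisson_le {η : Measure ℝ} [IsFiniteMeasure η] {t r : ℝ}
    (ht : 0 ≤ t) (hr : 0 ≤ r) (hi : Integrable (fun x => Real.exp (-r * x)) η) (z : ℝ) :
    ∫ x, putPayoff (z + x) ∂compoundPoisson η t
      ≤ Real.exp (-r * z) * Real.exp (t * ∫ x, (Real.exp (-r * x) - 1) ∂η) := by
  have h := lintegral_exp_compoundPoisson ht hi
  have hint : Integrable (fun x => Real.exp (-r * x)) (compoundPoisson η t) := by
    refine ⟨by fun_prop, ?_⟩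
    rw [hasFiniteIntegral_iff_ofReal (Eventually.of_forall fun x => (Real.exp_pos _).le), h]
    exact ENNReal.ofReal_lt_top
  have hval : ∫ x, Real.exp (-r * x) ∂compoundPoisson η t
      = Real.exp (t * ∫ x, (Real.exp (-r * x) - 1) ∂η) := by
    rw [integral_eq_lintegral_of_nonneg_ae (Eventually.of_forall fun x => (Real.exp_pos _).le)
      hint.1, h, ENNReal.toReal_ofReal (Real.exp_pos _).le]
  rw [← hval, ← integral_const_mul]
  refine integral_mono (integrable_compoundPoisson ht
    (continuous_putPayoff.comp (by fun_prop)).stronglyMeasurable (fun x => abs_putPayoff_le _))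
    (hint.const_mul _) fun x => ?_
  simp only
  rw [← Real.exp_add, ← mul_add]
  exact putPayoff_le_exp hr _

/-- Small-time expansion of the put price for the approximating processes, uniformly in the
log-moneyness. -/
lemma exists_abs_integral_approxLaw_sub_le (hν : IsLevyMeasure ν) (hs : HasSmoothDensity ν s)
    (hc : IsTruncation ε c) (hε : 0 < ε) (hε1 : ε < 1) (n : ℕ) :
    ∃ B K : ℝ, ∀ δ, 0 < δ → δ ≤ 1 → ∀ t, 0 ≤ t → t ≤ 1 → ∀ r, 0 ≤ r → ∀ z,
      |∫ x, putPayoff (z + x) ∂approxLaw (smallDrift b c ν) σ (smallJumps c ν) (largeJumps c ν) δ t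
        - Real.exp (-(jumpIntensity c ν * t)) * ∑ j ∈ Finset.Icc 1 n,
          itmCoeff b σ c s ν j z * (t ^ j / j.factorial)|
      ≤ Real.exp (-r * z) * Real.exp (t * ∫ x, (Real.exp (-r * x) - 1)
          ∂jumpApprox (smallDrift b c ν) σ (smallJumps c ν) δ)
        + (B * t ^ (n + 1) + K * approxError (smallDrift b c ν) σ (smallJumps c ν) δ) := by
  have hρ := isFiniteMeasure_largeJumps hν hc hε hε1
  have hγ := integrable_sq_smallJumps hν hc hε1
  have hγ1 : ∀ᵐ x ∂smallJumps c ν, |x| ≤ 1 :=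
    (ae_abs_le_smallJumps hc).mono fun x hx => hx.trans hε1.le
  set β := smallDrift b c ν
  set γ := smallJumps c ν
  set ρ := largeJumps c ν
  set Λ := ρ.real Set.univ with hΛ
  have hΛ0 : 0 ≤ Λ := measureReal_nonneg
  have hF : ∀ k, 1 ≤ k → IsBddSmooth (putSmoothed c s k 0) := fun k hk =>
    isBddSmooth_putSmoothed hν hs hc hε hε1 hk
  -- Order n + 1 - k suffices because the weight t^k supplies the other powers of t. The case k = 0
  -- is left vacuous: the payoff itself is not smooth and is handled by the exponential bound.
  have hex : ∀ k, ∃ M K : ℝ, 1 ≤ k → 0 ≤ M ∧ ∀ δ, 0 < δ → δ ≤ 1 → ∀ t, 0 ≤ t → t ≤ 1 → ∀ y,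
      |∫ x, putSmoothed c s k 0 (y + x) ∂compoundPoisson (jumpApprox β σ γ δ) t -
        ∑ q ∈ Finset.range (n + 1 - k), t ^ q / q.factorial *
          (levyGenerator β σ γ)^[q] (putSmoothed c s k 0) y|
        ≤ M * (t ^ (n + 1 - k) / (n + 1 - k).factorial) + K * approxError β σ γ δ := fun k => by
    by_cases hk : 1 ≤ k
    · obtain ⟨M, hM0, hM⟩ :=
        (IsBddSmooth.levyGenerator_iterate (β := β) (σ := σ) hγ (hF k hk) (n + 1 - k)).bounded
      obtain ⟨K, -, hK⟩ := abs_integral_compoundPoisson_sub_taylor_le hγ hγ1 (n + 1 - k) (hF k hk) hM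
      exact ⟨M, K, fun _ => ⟨hM0, hK⟩⟩
    · exact ⟨0, 0, fun h => absurd h hk⟩
  choose M K hMK using hex
  refine ⟨∑ k ∈ Finset.Icc 1 n, M k + Real.exp Λ, ∑ k ∈ Finset.Icc 1 n, |K k|,
    fun δ hδ hδ1 t ht ht1 r hr z => ?_⟩
  have hη := isFiniteMeasure_jumpApprox (β := β) (σ := σ) hγ hδ
  have he0 : 0 ≤ approxError β σ γ δ := approxError_nonneg hδ
  set η := jumpApprox β σ γ δ with hηdef
  have hprob := isProbabilityMeasure_compoundPoisson (η := η) ht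
  have hsum := hasSum_integral_conv_compoundPoisson (η := η) (ρ := ρ)
    (g := fun x => putPayoff (z + x)) (continuous_putPayoff.comp (by fun_prop))
    (fun x => abs_putPayoff_le _) ht
  set a : ℕ → ℝ := fun k => ∫ x, ∫ u, putPayoff (z + (x + u)) ∂convPowMeasure ρ k
    ∂compoundPoisson η t with ha
  set T : ℕ → ℝ := fun k => ∑ q ∈ Finset.range (n + 1 - k), t ^ q / q.factorial *
    (levyGenerator β σ γ)^[q] (putSmoothed c s k 0) z with hT
  have ha1 : ∀ k, |a k| ≤ Λ ^ k := fun k => by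
    have h := norm_integral_le_of_norm_le_const (μ := compoundPoisson η t) (C := Λ ^ k)
      (f := fun x => ∫ u, putPayoff (z + (x + u)) ∂convPowMeasure ρ k)
      (Eventually.of_forall fun x => by
        have := norm_integral_convPowMeasure_le (η := ρ) (f := fun u => putPayoff (z + (x + u)))
          (fun u => abs_putPayoff_le _) k
        simpa using this)
    simpa using h
  have main := abs_sub_sum_Icc_le (T := T) n hΛ0 ht ht1 ha1 hsum
  have hcoef : ∑ j ∈ Finset.Icc 1 n, itmCoeff b σ c s ν j z * (t ^ j / j.factorial)
      = ∑ k ∈ Finset.Icc 1 n, t ^ k / k.factorial * T k := by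
    rw [hT, ← sum_Icc_choose_mul_eq (fun q k => (levyGenerator β σ γ)^[q] (putSmoothed c s k 0) z)]
    refine Finset.sum_congr rfl fun j _ => ?_
    rw [itmCoeff]
    simp only [iterCoeff_eq hc hε1, add_zero]
    rfl
  have ha0 : |a 0| ≤ Real.exp (-r * z) * Real.exp (t * ∫ x, (Real.exp (-r * x) - 1) ∂η) := by
    have e : a 0 = ∫ x, putPayoff (z + x) ∂compoundPoisson η t := by simp [ha, convPowMeasure]
    rw [e, abs_of_nonneg (integral_nonneg fun x => putPayoff_nonneg _)]
    exact integral_putPayoff_compoundPoisson_le ht hr (integrable_exp_jumpApprox hγ hγ1 hδ _) z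
  have hk : ∀ k ∈ Finset.Icc 1 n, t ^ k / k.factorial * |a k - T k|
      ≤ M k * t ^ (n + 1) + |K k| * approxError β σ γ δ := fun k hk => by
    rw [Finset.mem_Icc] at hk
    obtain ⟨hM0, hK⟩ := hMK k hk.1
    have e : a k = ∫ x, putSmoothed c s k 0 (z + x) ∂compoundPoisson η t := by
      refine integral_congr_ae (Eventually.of_forall fun x => ?_)
      simp only [putSmoothed_eq_integral hν hs hc hε hε1 hk.1, add_assoc]
      rfl
    have h1 := hK δ hδ hδ1 t ht ht1 z
    rw [← hηdef, ← e] at h1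
    have hfac : ∀ m : ℕ, (1 : ℝ) ≤ m.factorial := fun m => by
      exact_mod_cast Nat.one_le_iff_ne_zero.2 (Nat.factorial_ne_zero m)
    have h2 : t ^ k / k.factorial ≤ t ^ k := div_le_self (by positivity) (hfac k)
    have h3 : t ^ (n + 1 - k) / (n + 1 - k).factorial ≤ t ^ (n + 1 - k) :=
      div_le_self (by positivity) (hfac _)
    have h4 : |a k - T k| ≤ M k * t ^ (n + 1 - k) + |K k| * approxError β σ γ δ := by
      refine h1.trans ?_
      gcongr
      exact le_abs_self _
    calc t ^ k / k.factorial * |a k - T k|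
        ≤ t ^ k * (M k * t ^ (n + 1 - k) + |K k| * approxError β σ γ δ) := by gcongr
      _ = M k * t ^ (n + 1) + t ^ k * (|K k| * approxError β σ γ δ) := by
          have : t ^ (n + 1) = t ^ k * t ^ (n + 1 - k) := by rw [← pow_add]; congr 1; omega
          rw [this]; ring
      _ ≤ _ := by
          refine add_le_add le_rfl ?_
          exact mul_le_of_le_one_left (by positivity) (pow_le_one₀ ht ht1)
  have hk' := Finset.sum_le_sum hk
  rw [Finset.sum_add_distrib, ← Finset.sum_mul, ← Finset.sum_mul] at hk'
  rw [jumpIntensity_eq hc, hcoef, mul_comm (Measure.real _ _) t]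
  refine main.trans ?_
  linarith

/-- Small-time expansion of the put price, uniformly in the log-moneyness. -/
lemma exists_abs_integral_putPayoff_sub_le (hZ : IsLevyProcessWithTriplet Z P b σ ν)
    (hs : HasSmoothDensity ν s) (hc : IsTruncation ε c) (hε : 0 < ε) (hε1 : ε < 1) (n : ℕ) :
    ∃ B : ℝ, ∀ t : ℝ≥0, (t : ℝ) ≤ 1 → ∀ r, 0 ≤ r → ∀ z,
      |∫ w, putPayoff (z + Z t w) ∂P
        - Real.exp (-(jumpIntensity c ν * t)) * ∑ j ∈ Finset.Icc 1 n,
          itmCoeff b σ c s ν j z * ((t : ℝ) ^ j / j.factorial)|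
      ≤ Real.exp (-r * z) *
          Real.exp (t * smallCumulant (smallDrift b c ν) σ (smallJumps c ν) (-r))
        + B * (t : ℝ) ^ (n + 1) := by
  have hν := hZ.levyMeasure
  have hρ := isFiniteMeasure_largeJumps hν hc hε hε1
  have hγ := integrable_sq_smallJumps hν hc hε1
  have hγ1 : ∀ᵐ x ∂smallJumps c ν, |x| ≤ 1 :=
    (ae_abs_le_smallJumps hc).mono fun x hx => hx.trans hε1.le
  obtain ⟨B, K, hBK⟩ := exists_abs_integral_approxLaw_sub_le (b := b) (σ := σ) hν hs hc hε hε1 n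
  refine ⟨B, fun t ht1 r hr z => ?_⟩
  obtain ⟨hd, hd0⟩ := tendsto_inv_nat_add_one
  have hm := hZ.levyProcess.measurable t
  let μ : ℕ → ProbabilityMeasure ℝ := fun m =>
    ⟨approxLaw (smallDrift b c ν) σ (smallJumps c ν) (largeJumps c ν) (1 / ((m : ℝ) + 1)) t,
      isProbabilityMeasure_approxLaw hγ (hd m).1 t.coe_nonneg⟩
  let μ₀ : ProbabilityMeasure ℝ := ⟨P.map (Z t), Measure.isProbabilityMeasure_map hm.aemeasurable⟩
  have hlim : Tendsto μ atTop (𝓝 μ₀) :=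
    tendsto_approxLaw hZ hc hε hε1 hd hd0 t (fun m => rfl) rfl
  have hput := (ProbabilityMeasure.tendsto_iff_forall_integral_tendsto.1 hlim)
    (BoundedContinuousFunction.ofNormedAddCommGroup (fun x => putPayoff (z + x))
      (continuous_putPayoff.comp (by fun_prop)) 1 (fun x => abs_putPayoff_le _))
  simp only [BoundedContinuousFunction.coe_ofNormedAddCommGroup] at hput
  have hμ₀ : ∫ x, putPayoff (z + x) ∂(μ₀ : Measure ℝ) = ∫ w, putPayoff (z + Z t w) ∂P := by
    change ∫ x, putPayoff (z + x) ∂(P.map (Z t)) = _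
    exact integral_map hm.aemeasurable (f := fun x => putPayoff (z + x))
      (continuous_putPayoff.comp (by fun_prop)).aestronglyMeasurable
  rw [hμ₀] at hput
  -- Here t, r and z are fixed while δ → 0. As B and K do not depend on δ, the approximation error
  -- disappears and the cumulant of the approximation becomes that of the small-jump part.
  have hrhs := ((((Real.continuous_exp.tendsto _).comp ((tendsto_integral_exp_jumpApprox
    (β := smallDrift b c ν) (σ := σ) hγ hγ1 hd hd0 (-r)).const_mul (t : ℝ))).const_mul
      (Real.exp (-r * z))).add (((tendsto_approxError (β := smallDrift b c ν) (σ := σ) hγ hd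
        hd0).const_mul K).const_add (B * (t : ℝ) ^ (n + 1))))
  rw [mul_zero, add_zero] at hrhs
  exact le_of_tendsto_of_tendsto ((hput.sub_const _).abs) hrhs (Eventually.of_forall fun m =>
    hBK _ (hd m).1 (hd m).2 t t.coe_nonneg ht1 r hr z)

end triplet

end ExpLevy

end

/-! ### The main theorem. -/

theorem mainTheorem9 {Ω : Type*} [MeasurableSpace Ω] (P : Measure Ω) [IsProbabilityMeasure P]
    (Z : ℝ≥0 → Ω → ℝ) (b σ : ℝ) (ν : Measure ℝ) (s : ℝ → ℝ)
    (hZ : ExpLevy.IsLevyProcessWithTriplet Z P b σ ν)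
    (hs : ExpLevy.HasSmoothDensity ν s)
    (hexp : ∃ κ : ℝ, 2 < κ ∧ IntegrableOn (fun z : ℝ => Real.exp (κ * |z|)) {z : ℝ | 1 < |z|} ν)
    (hb : b = -(σ ^ 2 / 2) - ∫ z, (Real.exp z - 1 - ExpLevy.truncId z) ∂ν)
    (z₀ : ℝ) (hz₀ : 0 < z₀) (n : ℕ) (hn : 1 ≤ n)
    (ε : ℝ) (hε : 0 < ε) (hε' : ε < min (z₀ / (n + 1)) 1)
    (c : ℝ → ℝ) (hc : ExpLevy.IsTruncation ε c) :
    (∀ (t : ℝ≥0) (z : ℝ), Integrable (fun w => ExpLevy.callPayoff z (Z t w)) P) ∧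
    (∀ (k : ℕ) (z : ℝ), 1 ≤ k → z₀ < z →
      (∀ y : ℝ, Integrable (fun u : ℝ => max (-(Real.exp (z + y + u) - 1)) 0 *
        ExpLevy.convPow (ExpLevy.largeDensity c s) k u)) ∧
      ∀ q : ℕ, ContDiff ℝ ∞ (ExpLevy.iterCoeff b σ c s ν q k z) ∧
        ∀ y : ℝ, Integrable
          (ExpLevy.generatorIntegrand c (ExpLevy.iterCoeff b σ c s ν q k z) y) ν) ∧
    ∃ t₀ : ℝ, 0 < t₀ ∧ ∃ C : ℝ, ∀ (t : ℝ≥0) (z : ℝ), 0 < t → (t : ℝ) < t₀ → z₀ < z →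
      |ExpLevy.callPrice P Z t z -
          (Real.exp z - 1 + Real.exp (-(ExpLevy.jumpIntensity c ν * t)) *
            ∑ j ∈ Finset.Icc 1 n,
              ExpLevy.itmCoeff b σ c s ν j z * ((t : ℝ) ^ j / (j.factorial : ℝ)))|
        ≤ C * (t : ℝ) ^ (n + 1) := by
  have hε1 : ε < 1 := hε'.trans_le (min_le_right _ _)
  have hν := hZ.levyMeasure
  have hγ := ExpLevy.integrable_sq_smallJumps hν hc hε1
  have hexpZ := ExpLevy.integrable_exp_and_integral_eq_one hZ hc hε hε1 hexp hb
  have hmZ := hZ.levyProcess.measurable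
  refine ⟨fun t z => (ExpLevy.integrable_callPayoff (hmZ t) (hexpZ t).1 z).2,
    fun k z hk _ => ⟨fun y => ?_, fun q => ?_⟩, ?_⟩
  · obtain ⟨k, rfl⟩ := Nat.exists_eq_add_of_le' hk
    exact ExpLevy.integrable_putPayoff_mul (ExpLevy.convPow_succ_spec
      (ExpLevy.isBddSmooth_largeDensity hs hc hε hε1)
      (ExpLevy.integrable_largeDensity hν hs hc hε hε1)
      (ExpLevy.largeDensity_nonneg hs hc hε) k).2.1 (z + y)
  · have hsm : ExpLevy.IsBddSmooth (ExpLevy.iterCoeff b σ c s ν q k z) := by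
      rw [ExpLevy.iterCoeff_eq hc hε1]
      exact ((ExpLevy.isBddSmooth_putSmoothed hν hs hc hε hε1 hk).levyGenerator_iterate hγ
        q).comp_const_add z
    refine ⟨hsm.contDiff, fun y => ?_⟩
    refine ((ExpLevy.integrable_densityMeasure_iff hc.measurable hc.nonneg).1
      (hsm.integrable_taylor hγ y)).congr (Eventually.of_forall fun x => ?_)
    exact ExpLevy.smul_generatorIntegrand hc hε1 _ y x
  · have hn0 : (0 : ℝ) < n + 1 := by positivity
    -- Applied with ε' = z₀/(n+1); this is where the bound ε < z₀/(n+1) enters.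
    obtain ⟨C₀, hC₀⟩ := ExpLevy.exists_exp_smallCumulant_le
      (β := ExpLevy.smallDrift b c ν) (σ := σ) hγ (ExpLevy.ae_abs_le_smallJumps hc) hε
      (hε'.trans_le (min_le_left _ _))
    obtain ⟨B, hB⟩ := ExpLevy.exists_abs_integral_putPayoff_sub_le hZ hs hc hε hε1 n
    refine ⟨1, one_pos, Real.exp C₀ + B, fun t z ht ht1 hz => ?_⟩
    have ht0 : (0 : ℝ) < t := by exact_mod_cast ht
    -- Chosen so that e^{-r z₀} = t^{n+1}; since r ≥ 0, every z > z₀ does at least as well.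
    set r := -Real.log t / (z₀ / (n + 1)) with hr
    have hr0 : 0 ≤ r :=
      div_nonneg (neg_nonneg.2 (Real.log_nonpos ht0.le ht1.le)) (by positivity)
    have h1 : Real.exp (-r * z) ≤ (t : ℝ) ^ (n + 1) := by
      have e : -r * z₀ = ((n + 1 : ℕ) : ℝ) * Real.log t := by
        rw [hr]; push_cast; field_simp
      calc Real.exp (-r * z) ≤ Real.exp (-r * z₀) := Real.exp_le_exp.2 (by nlinarith)
        _ = (t : ℝ) ^ (n + 1) := by rw [e, Real.exp_nat_mul, Real.exp_log ht0]
    have h2 := hB t ht1.le r hr0 z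
    have h3 : Real.exp (-r * z) * Real.exp (t * ExpLevy.smallCumulant (ExpLevy.smallDrift b c ν) σ
        (ExpLevy.smallJumps c ν) (-r)) ≤ (t : ℝ) ^ (n + 1) * Real.exp C₀ :=
      mul_le_mul h1 (Real.exp_le_exp.2 (hC₀ t ht0 ht1.le)) (Real.exp_pos _).le (by positivity)
    rw [ExpLevy.callPrice_eq (hmZ t) (hexpZ t).1 (hexpZ t).2 z, add_sub_add_left_eq_sub]
    refine h2.trans ?_
    rw [add_mul]
    linarith
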